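/- Let $k$ be a field and let $A$ be a graded $k$-vector space, where the grading is by $\mathbb{Z}$ or by $\mathbb{Z}/N$ with $N$ even (so $\mathbb{Z}/2$-gradings are allowed). An $A_\infty$-algebra structure on $A$ consists of $k$-linear maps $m_n\colon A^{\otimes n}\to A$ of degree $2-n$, $n\ge 1$, such that for all $n\ge 1$ $$\sum_{r+s+t=n,\ s\ge 1}(-1)^{rs+t}\,m_{r+1+t}(\mathrm{id}^{\otimes r}\otimes m_s\otimes \mathrm{id}^{\otimes t})=0 ,$$ where tensor products of maps are evaluated by the Koszul sign rule. A morphism $f\colon (A,m)\to(B,m')$ consists of $k$-linear maps $f_n\colon A^{\otimes n}\to B$ of degree $1-n$, $n\ge1$, such that for all $n\ge1$ $$\sum_{i_1+\dots+i_l=n}(-1)^{\heartsuit}\,m'_l(f_{i_1}\otimes\cdots\otimes f_{i_l})=\sum_{r+s+t=n,\ s\ge 1}(-1)^{rs+t}f_{r+1+t}(\mathrm{id}^{\otimes r}\otimes m_s\otimes\mathrm{id}^{\otimes t}),\qquad \heartsuit=\sum_{j}(i_j-1)(i_1+\dots+i_{j-1}).$$ Composition is $(g\circ f)_n=\sum_{i_1+\dots+i_l=n}(-1)^{\heartsuit}g_l(f_{i_1}\otimes\cdots\otimes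 f_{i_l})$; the identity has $f_1=\mathrm{id}$ and $f_n=0$ for $n\neq 1$; an isomorphism is a morphism with a two-sided inverse; a quasi-isomorphism is a morphism for which $f_1$ induces an isomorphism on cohomology with respect to $m_1$. The algebra is minimal if $m_1=0$, and trivial if $m_n=0$ for all $n\ne2$. It is formal if it is quasi-isomorphic to a trivial $A_\infty$-algebra. Let $(A,m)$ be a minimal $A_\infty$-algebra, so that $(A,m_2)$ is a graded associative algebra. For $n\ge 0$ and $q\in\mathbb{Z}$ let $HH^{n,q}(A,m_2)$ be the cohomology, at the $k$-linear maps $\varphi\colon A^{\otimes n}\to A$ of degree $q$, of the Hochschild differential $$(d\varphi)(a_1,\dots,a_{n+1})=(-1)^{q|a_1|}a_1\varphi(a_2,\dots,a_{n+1})+\sum_{i=1}^n(-1)^i\varphi(a_1,\dots,a_ia_{i+1},\dots,a_{n+1})+(-1)^{n+1}\varphi(a_1,\dots,a_n)a_{n+1}.$$ 1. Let $n\ge3$. If $m_l=0$ for $2<l<n$ and $HH^{n,2-n}(A,m_2)=0$, then there are a minimal $A_\infty$-structure $m'$ on $A$ with $m'_2=m_2$ and $m'_l=0$ for $2<l\le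 n$, and an $A_\infty$-isomorphism $f\colon(A,m)\to(A,m')$ with $f_1=\mathrm{id}$ and $f_l=0$ for $1<l<n-1$. 2. Let $M\ge0$. If $HH^{n,2-n}(A,m_2)=0$ for $3\le n\le M$, then there are a minimal $A_\infty$-structure $m'$ on $A$ with $m'_2=m_2$ and $m'_l=0$ for $3\le l\le M$, and an $A_\infty$-isomorphism $f\colon(A,m)\to(A,m')$ with $f_1=\mathrm{id}$. 3. If $HH^{n,2-n}(A,m_2)=0$ for all $n\ge3$, then there are minimal $A_\infty$-structures $m=m^{(0)},m^{(1)},m^{(2)},\dots$ on $A$, with $m^{(j)}_2=m_2$ and $m^{(j)}_l=0$ for $3\le l\le j+2$, and $A_\infty$-isomorphisms $g^{(j)}\colon(A,m^{(j)})\to(A,m^{(j+1)})$ with $g^{(j)}_1=\mathrm{id}$ and $g^{(j)}_l=0$ for $1<l<j+2$, such that the composites $F^{(j)}=g^{(j-1)}\circ\cdots\circ g^{(0)}$ converge: there is an $A_\infty$-isomorphism $\Phi$ from $(A,m)$ to the trivial $A_\infty$-algebra with the single operation $m_2$ such that $\Phi_1=\mathrm{id}$ and $F^{(j)}_n=\Phi_n$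 whenever $j\ge n-1$. In particular $(A,m)$ is formal. -/

import Mathlib

/-!
# Minimal A-infinity algebras, Hochschild cohomology and formality

Gradings are indexed by `ZMod N` with `N` even: `N = 0` gives `ℤ`-graded modules (`ZMod 0 = ℤ`) and
`N = 2` gives `ℤ/2`-graded ones.  A `k`-linear map `V^{⊗n} → W` is a `MultilinearMap` on `Fin n → V`.
To avoid reindexing, the arguments `a₁, …, aₙ` of such maps are the first terms `a 0, …, a (n - 1)`
of a sequence `a : ℕ → V`; the other terms play no role.
-/

namespace AInf

section Graded

variable {k : Type*} [Field k] {N : ℕ}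
variable {V : Type*} [AddCommGroup V] [Module k V]
variable {W : Type*} [AddCommGroup W] [Module k W]
variable {X : Type*} [AddCommGroup X] [Module k X]

/-- `φ : V^{⊗n} → W` is homogeneous of degree `q`. -/
def IsHomogeneous (𝒜 : ZMod N → Submodule k V) (ℬ : ZMod N → Submodule k W) {n : ℕ}
    (φ : MultilinearMap k (fun _ : Fin n => V) W) (q : ℤ) : Prop :=
  ∀ (d : Fin n → ZMod N) (a : Fin n → V), (∀ i, a i ∈ 𝒜 (d i)) →
    φ a ∈ ℬ ((∑ i, d i) + (q : ZMod N))

/-- The linear map `x ↦ (-1)^{q |x|} x`: the Koszul sign for moving a map of degree `q` past `x`.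
For even `N` the parity of `d : ZMod N` is the parity of `d.val` (if `N = 0`, of `|d|`). -/
noncomputable def koszul (𝒜 : ZMod N → Submodule k V) [DirectSum.Decomposition 𝒜] (q : ℤ) :
    V →ₗ[k] V :=
  (DirectSum.toModule k (ZMod N) V
      (fun d => ((-1 : k) ^ (q.natAbs * d.val)) • (𝒜 d).subtype)).comp
    (DirectSum.decomposeLinearEquiv 𝒜).toLinearMap

theorem koszul_of_mem (𝒜 : ZMod N → Submodule k V) [DirectSum.Decomposition 𝒜] (q : ℤ)
    {d : ZMod N} {x : V} (hx : x ∈ 𝒜 d) :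
    koszul 𝒜 q x = ((-1 : k) ^ (q.natAbs * d.val)) • x := by
  have h : DirectSum.decomposeLinearEquiv 𝒜 x = DirectSum.lof k (ZMod N) (fun i => 𝒜 i) d ⟨x, hx⟩ :=
    DirectSum.decompose_of_mem 𝒜 hx
  simp only [koszul, LinearMap.comp_apply, LinearEquiv.coe_coe, h, DirectSum.toModule_lof,
    LinearMap.smul_apply, Submodule.subtype_apply]

/-- `(id^{⊗r} ⊗ φ ⊗ id^{⊗t})(a)` for `φ : V^{⊗s} → V` of degree `q`, as a sequence of elements: the
Koszul rule puts the sign `(-1)^{q |a_i|}` on the `r` arguments standing before `φ`. -/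
noncomputable def splice (𝒜 : ZMod N → Submodule k V) [DirectSum.Decomposition 𝒜] (q : ℤ) (r : ℕ)
    {s : ℕ} (φ : MultilinearMap k (fun _ : Fin s => V) V) (a : ℕ → V) : ℕ → V :=
  fun i => if i < r then koszul 𝒜 q (a i)
    else if i = r then φ (fun j => a (r + j))
    else a (i + s - 1)

/-- `∑_{r+s+t=n, s≥1} (-1)^{rs+t} f_{r+1+t} (id^{⊗r} ⊗ m_s ⊗ id^{⊗t})` at `a₁, …, aₙ`, where `m_s` has
degree `2 - s`. -/
noncomputable def insertSum (𝒜 : ZMod N → Submodule k V) [DirectSum.Decomposition 𝒜]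
    (f : ∀ n : ℕ, MultilinearMap k (fun _ : Fin n => V) W)
    (m : ∀ n : ℕ, MultilinearMap k (fun _ : Fin n => V) V) (n : ℕ) (a : ℕ → V) : W :=
  ∑ s ∈ Finset.Icc 1 n, ∑ r ∈ Finset.range (n - s + 1),
    ((-1 : k) ^ (r * s + (n - r - s))) •
      f (n - s + 1) (fun i => splice 𝒜 (2 - (s : ℤ)) r (m s) a i)

/-- `∑ (-1)^♥ g_l (f_{i₁} ⊗ ⋯ ⊗ f_{i_l})` at `a₁, …, aₙ`, over all `i₁ + ⋯ + i_l = n` with `i_j ≥ 1`,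
where `f_i` has degree `1 - i` and `♥ = ∑_j (i_j - 1) (i₁ + ⋯ + i_{j-1})`.  By the Koszul rule each
argument of the `j`-th factor gets the sign for all the factors `f_{i_{j'}}`, `j' > j`. -/
noncomputable def compSum (𝒜 : ZMod N → Submodule k V) [DirectSum.Decomposition 𝒜]
    (g : ∀ n : ℕ, MultilinearMap k (fun _ : Fin n => W) X)
    (f : ∀ n : ℕ, MultilinearMap k (fun _ : Fin n => V) W) (n : ℕ) (a : ℕ → V) : X :=
  ∑ c : Composition n,
    ((-1 : k) ^ (∑ j : Fin c.length, (c.blocksFun j - 1) * c.sizeUpTo j)) •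
      g c.length (fun j => f (c.blocksFun j) (fun i =>
        koszul 𝒜 (∑ j' ∈ Finset.Ioi j, (1 - (c.blocksFun j' : ℤ))) (a (c.sizeUpTo j + i))))

/-- The components of the identity morphism: `id` in arity `1` and zero in all other arities. -/
noncomputable def idMaps (k V : Type*) [Field k] [AddCommGroup V] [Module k V] :
    ∀ n : ℕ, MultilinearMap k (fun _ : Fin n => V) V
  | 1 => MultilinearMap.ofSubsingleton k V V 0 LinearMap.id
  | _ => 0

/-- A multilinear map of arity one as a linear map. -/
noncomputable def linearPart (φ : MultilinearMap k (fun _ : Fin 1 => V) W) : V →ₗ[k] W :=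
  (MultilinearMap.ofSubsingleton k V W 0).symm φ

end Graded

/-- A (non-curved) A-infinity structure on the graded vector space `𝒜`.  There is no operation of
arity `0`; it is recorded as `m 0 = 0`. -/
structure Algebra {k : Type*} [Field k] {N : ℕ} {V : Type*} [AddCommGroup V] [Module k V]
    (𝒜 : ZMod N → Submodule k V) [DirectSum.Decomposition 𝒜] where
  m : ∀ n : ℕ, MultilinearMap k (fun _ : Fin n => V) V
  m_zero : m 0 = 0
  homogeneous : ∀ n : ℕ, 1 ≤ n → IsHomogeneous 𝒜 𝒜 (m n) (2 - (n : ℤ))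
  relation : ∀ n : ℕ, 1 ≤ n → ∀ a : ℕ → V, insertSum 𝒜 m m n a = 0

/-- A morphism of A-infinity algebras.  There is no component of arity `0`; it is recorded as
`f 0 = 0`. -/
structure Hom {k : Type*} [Field k] {N : ℕ} {V : Type*} [AddCommGroup V] [Module k V]
    {𝒜 : ZMod N → Submodule k V} [DirectSum.Decomposition 𝒜]
    {W : Type*} [AddCommGroup W] [Module k W]
    {ℬ : ZMod N → Submodule k W} [DirectSum.Decomposition ℬ]
    (A : Algebra 𝒜) (B : Algebra ℬ) where
  f : ∀ n : ℕ, MultilinearMap k (fun _ : Fin n => V) W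
  f_zero : f 0 = 0
  homogeneous : ∀ n : ℕ, 1 ≤ n → IsHomogeneous 𝒜 ℬ (f n) (1 - (n : ℤ))
  relation : ∀ n : ℕ, 1 ≤ n → ∀ a : ℕ → V, compSum 𝒜 B.m f n a = insertSum 𝒜 f A.m n a

section Properties

variable {k : Type*} [Field k] {N : ℕ}
variable {V : Type*} [AddCommGroup V] [Module k V]
variable {𝒜 : ZMod N → Submodule k V} [DirectSum.Decomposition 𝒜]
variable {W : Type*} [AddCommGroup W] [Module k W]
variable {ℬ : ZMod N → Submodule k W} [DirectSum.Decomposition ℬ]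
variable {X : Type*} [AddCommGroup X] [Module k X]
variable {𝒞 : ZMod N → Submodule k X} [DirectSum.Decomposition 𝒞]

/-- The differential `m₁`. -/
noncomputable def Algebra.d (A : Algebra 𝒜) : V →ₗ[k] V := linearPart (A.m 1)

/-- `A` is minimal: `m₁ = 0`. -/
def Algebra.IsMinimal (A : Algebra 𝒜) : Prop := A.m 1 = 0

/-- The only operation of `A` is the product `m₂`. -/
def Algebra.IsTrivial (A : Algebra 𝒜) : Prop := ∀ n : ℕ, n ≠ 2 → A.m n = 0

/-- `H` is the composite of `F : A → B` and `G : B → C`. -/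
def Hom.IsComp {A : Algebra 𝒜} {B : Algebra ℬ} {C : Algebra 𝒞}
    (G : Hom B C) (F : Hom A B) (H : Hom A C) : Prop :=
  ∀ n : ℕ, 1 ≤ n → ∀ a : ℕ → V, H.f n (fun i => a i) = compSum 𝒜 G.f F.f n a

/-- `F` is an isomorphism of A-infinity algebras: it has a two-sided inverse. -/
def Hom.IsIso {A : Algebra 𝒜} {B : Algebra ℬ} (F : Hom A B) : Prop :=
  ∃ G : Hom B A,
    (∀ n : ℕ, 1 ≤ n → ∀ a : ℕ → V, compSum 𝒜 G.f F.f n a = idMaps k V n (fun i => a i)) ∧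
    (∀ n : ℕ, 1 ≤ n → ∀ b : ℕ → W, compSum ℬ F.f G.f n b = idMaps k W n (fun i => b i))

/-- `F` is a quasi-isomorphism: the map induced by `f₁` on the cohomology `ker m₁ / im m₁` is
injective and surjective. -/
def Hom.IsQuasiIso {A : Algebra 𝒜} {B : Algebra ℬ} (F : Hom A B) : Prop :=
  (∀ x ∈ LinearMap.ker A.d, linearPart (F.f 1) x ∈ LinearMap.range B.d → x ∈ LinearMap.range A.d) ∧
  (∀ y ∈ LinearMap.ker B.d, ∃ x ∈ LinearMap.ker A.d,
    linearPart (F.f 1) x - y ∈ LinearMap.range B.d)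

end Properties

/-- `A` is formal: it is quasi-isomorphic to an A-infinity algebra whose only operation is `m₂` (which
is then isomorphic to the cohomology algebra of `A`). -/
def Algebra.IsFormal.{u, v} {k : Type u} [Field k] {N : ℕ} {V : Type v} [AddCommGroup V] [Module k V]
    {𝒜 : ZMod N → Submodule k V} [DirectSum.Decomposition 𝒜] (A : Algebra 𝒜) : Prop :=
  ∃ (W : Type v) (_ : AddCommGroup W) (_ : Module k W) (ℬ : ZMod N → Submodule k W)
    (_ : DirectSum.Decomposition ℬ) (B : Algebra ℬ) (F : Hom A B), B.IsTrivial ∧ F.IsQuasiIso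

section Hochschild

variable {k : Type*} [Field k] {N : ℕ} {V : Type*} [AddCommGroup V] [Module k V]
variable (𝒜 : ZMod N → Submodule k V) [DirectSum.Decomposition 𝒜]

/-- The Hochschild cochains `V^{⊗n} → V` that are homogeneous of degree `q`. -/
def hochschildCochains (n : ℕ) (q : ℤ) : Submodule k (MultilinearMap k (fun _ : Fin n => V) V) where
  carrier := {φ | IsHomogeneous 𝒜 𝒜 φ q}
  add_mem' hφ hψ := fun d a ha => Submodule.add_mem _ (hφ d a ha) (hψ d a ha)
  zero_mem' := fun _ _ _ => Submodule.zero_mem _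
  smul_mem' c _ hφ := fun d a ha => Submodule.smul_mem _ c (hφ d a ha)

/-- A multilinear map as a function of sequences (of which only the first `n` terms matter). -/
def evalSeq (k V : Type*) [Field k] [AddCommGroup V] [Module k V] (n : ℕ) :
    MultilinearMap k (fun _ : Fin n => V) V →ₗ[k] ((ℕ → V) → V) where
  toFun φ := fun a => φ (fun i => a i)
  map_add' _ _ := rfl
  map_smul' _ _ := rfl

/-- The Hochschild differential, on `n`-cochains of degree `q`, of the graded algebra with product
`μ`:
`(dφ)(a₁, …, a_{n+1}) = (-1)^{q |a₁|} a₁ φ(a₂, …, a_{n+1})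
  + ∑_{1 ≤ i ≤ n} (-1)^i φ(a₁, …, a_i a_{i+1}, …, a_{n+1}) + (-1)^{n+1} φ(a₁, …, a_n) a_{n+1}`,
as a function of sequences (of which only the first `n + 1` terms matter). -/
noncomputable def hochschildDiff (μ : MultilinearMap k (fun _ : Fin 2 => V) V) (n : ℕ) (q : ℤ) :
    MultilinearMap k (fun _ : Fin n => V) V →ₗ[k] ((ℕ → V) → V) where
  toFun φ := fun a =>
    μ ![koszul 𝒜 q (a 0), φ (fun i => a (i + 1))]
      + ∑ r ∈ Finset.range n, ((-1 : k) ^ (r + 1)) • φ (fun i => splice 𝒜 0 r μ a i)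
      + ((-1 : k) ^ (n + 1)) • μ ![φ (fun i => a i), a n]
  map_add' φ ψ := by
    have h1 : ∀ x y z : V, μ ![x, y + z] = μ ![x, y] + μ ![x, z] := fun x y z => by
      have e : ∀ w : V, Function.update ![x, 0] (1 : Fin 2) w = ![x, w] := fun w => by
        funext i; fin_cases i <;> simp
      simpa only [e] using μ.map_update_add ![x, 0] 1 y z
    have h2 : ∀ x y z : V, μ ![y + z, x] = μ ![y, x] + μ ![z, x] := fun x y z => by
      have e : ∀ w : V, Function.update ![0, x] (0 : Fin 2) w = ![w, x] := fun w => by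
        funext i; fin_cases i <;> simp
      simpa only [e] using μ.map_update_add ![0, x] 0 y z
    funext a
    simp only [_root_.add_apply, Pi.add_apply, h1, h2, smul_add, Finset.sum_add_distrib]
    abel
  map_smul' c φ := by
    have h1 : ∀ x y : V, μ ![x, c • y] = c • μ ![x, y] := fun x y => by
      have e : ∀ w : V, Function.update ![x, 0] (1 : Fin 2) w = ![x, w] := fun w => by
        funext i; fin_cases i <;> simp
      simpa only [e] using μ.map_update_smul ![x, 0] 1 c y
    have h2 : ∀ x y : V, μ ![c • y, x] = c • μ ![y, x] := fun x y => by
      have e : ∀ w : V, Function.update ![0, x] (0 : Fin 2) w = ![w, x] := fun w => by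
        funext i; fin_cases i <;> simp
      simpa only [e] using μ.map_update_smul ![0, x] 0 c y
    funext a
    simp only [_root_.smul_apply, Pi.smul_apply, h1, h2, smul_add, Finset.smul_sum,
      RingHom.id_apply, smul_comm c]

/-- Hochschild `n`-cocycles of degree `q`. -/
noncomputable def hochschildCocycles (μ : MultilinearMap k (fun _ : Fin 2 => V) V) (n : ℕ) (q : ℤ) :
    Submodule k (MultilinearMap k (fun _ : Fin n => V) V) :=
  hochschildCochains 𝒜 n q ⊓ LinearMap.ker (hochschildDiff 𝒜 μ n q)

/-- Hochschild `n`-coboundaries of degree `q`: the maps `dψ` for an `(n-1)`-cochain `ψ` of degree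
`q`. -/
noncomputable def hochschildCoboundaries (μ : MultilinearMap k (fun _ : Fin 2 => V) V) :
    ∀ (n : ℕ) (_ : ℤ), Submodule k (MultilinearMap k (fun _ : Fin n => V) V)
  | 0, _ => ⊥
  | n + 1, q => hochschildCochains 𝒜 (n + 1) q ⊓
      ((hochschildCochains 𝒜 n q).map (hochschildDiff 𝒜 μ n q)).comap (evalSeq k V (n + 1))

/-- The Hochschild cohomology `HH^{n,q}` (arity `n`, internal degree `q`) of the graded associative
algebra with product `μ`, with coefficients in itself. -/
abbrev HochschildCohomology (μ : MultilinearMap k (fun _ : Fin 2 => V) V) (n : ℕ) (q : ℤ) : Type _ :=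
  hochschildCocycles 𝒜 μ n q ⧸
    (hochschildCoboundaries 𝒜 μ n q).comap (hochschildCocycles 𝒜 μ n q).subtype

end Hochschild

end AInf

/-! The proof goes through the bar construction. After shifting the grading by one, the operations
m_n are the components of a single function of degree one on words, and this function determines a
coderivation of the tensor coalgebra; the components of a morphism determine a coalgebra map. The
A-infinity relations say that the coderivation squares to zero, the morphism relations that the
coalgebra map intertwines two coderivations, and composition is composition of coalgebra maps.
Everything is written dually, on functions `Φ` of words: `pull f Φ` is `Φ` after the coalgebra map
of `f`, and `ins τ b Φ` is `Φ` after the coderivation of `b`. The signs are dealt with in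
`insertSum_eq_ins`, `compSum_eq_pull` and `hochschildDiff_eq`.

A family `f` with f_1 = id can be inverted recursively in the word length. Hence a morphism with
identity linear part is an isomorphism (`isIso_of_f_one`), and conjugating a structure by any such
family gives another structure (`exists_transport`). If m_1 = 0 and m_l = 0 for 2 < l < n, the
relation of arity n + 1 says that m_n is a Hochschild cocycle. When m_n = dψ, transport along the
identity plus ±ψ in arity n - 1 does not change the operations below n and replaces m_n by m_n - dψ
= 0 (`exists_remove_product`).

Iteration gives the result up to any finite order. For all orders, the j-th isomorphism vanishes in
arities 1 < l < j + 2, so the composites stabilise in every arity. A relation of arity n involves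
only components of arity at most n, so the stable values again form a morphism, now to the trivial
algebra (`exists_limit`). Between algebras with m_1 = 0, identity linear part makes it a
quasi-isomorphism. -/

namespace AInf

set_option linter.unusedSectionVars false

/-! ### Functions on words, deconcatenation, and substitution of a family of maps -/

section Words

variable {k : Type*} [Field k] {V : Type*} [AddCommGroup V] [Module k V]
variable {X : Type*} [AddCommGroup X] [Module k X] {Y : Type*} [AddCommGroup Y] [Module k Y]

/-- The sum of `H a c` over all decompositions `w = a ++ c`. -/
def splitSum (H : List V → List V → X) : List V → X
  | [] => H [] []
  | x :: w => H [] (x :: w) + splitSum (fun a c => H (x :: a) c) w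

theorem splitSum_congr {H H' : List V → List V → X} (w : List V)
    (h : ∀ a c, a ++ c = w → H a c = H' a c) : splitSum H w = splitSum H' w := by
  induction w generalizing H H' with
  | nil => exact h [] [] rfl
  | cons x w ih =>
    simp only [splitSum]
    rw [h [] (x :: w) rfl, ih fun a c hac => h (x :: a) c (by simp [hac])]

theorem splitSum_add (H H' : List V → List V → X) (w : List V) :
    splitSum (fun a c => H a c + H' a c) w = splitSum H w + splitSum H' w := by
  induction w generalizing H H' with
  | nil => rfl
  | cons x w ih => simp only [splitSum, ih]; abel

theorem splitSum_zero (w : List V) : splitSum (fun _ _ => (0 : X)) w = 0 := by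
  induction w with
  | nil => rfl
  | cons x w ih => simp only [splitSum, ih, add_zero]

theorem map_splitSum {L : X → Y} (hL : IsLinearMap k L) (H : List V → List V → X) (w : List V) :
    splitSum (fun a c => L (H a c)) w = L (splitSum H w) := by
  induction w generalizing H with
  | nil => rfl
  | cons x w ih => simp only [splitSum, ih, hL.map_add]

/-- Coassociativity of deconcatenation: both sides run over all ways to cut `w` into three words. -/
theorem splitSum_assoc (K : List V → List V → List V → X) (w : List V) :
    splitSum (fun a c => splitSum (K a) c) w =
      splitSum (fun a c => splitSum (fun a₁ a₂ => K a₁ a₂ c) a) w := by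
  induction w generalizing K with
  | nil => rfl
  | cons x w ih =>
    simp only [splitSum, ih, splitSum_add]
    abel

theorem splitSum_eq_sum (H : List V → List V → X) (w : List V) :
    splitSum H w = ∑ i ∈ Finset.range (w.length + 1), H (w.take i) (w.drop i) := by
  induction w generalizing H with
  | nil => simp [splitSum]
  | cons x w ih =>
    rw [splitSum, ih, List.length_cons, Finset.sum_range_succ' _ (w.length + 1), add_comm]
    simp

/-- Multilinear functions on words. -/
def IsML (k : Type*) [Field k] {V X : Type*} [AddCommGroup V] [Module k V] [AddCommGroup X]
    [Module k X] (Φ : List V → X) : Prop :=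
  ∀ u v, IsLinearMap k (fun x => Φ (u ++ x :: v))

theorem IsML.tail {Φ : List V → X} (h : IsML k Φ) (y : V) : IsML k (fun w => Φ (y :: w)) :=
  fun u v => h (y :: u) v

theorem IsML.head {Φ : List V → X} (h : IsML k Φ) (v : List V) :
    IsLinearMap k (fun x => Φ (x :: v)) := h [] v

theorem IsML.zero_cons {Φ : List V → X} (h : IsML k Φ) (v : List V) : Φ (0 :: v) = 0 :=
  (h.head v).map_zero

theorem IsML.add {Φ Ψ : List V → X} (hΦ : IsML k Φ) (hΨ : IsML k Ψ) :
    IsML k (fun w => Φ w + Ψ w) := fun u v =>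
  ⟨fun x y => by dsimp only; rw [(hΦ u v).map_add, (hΨ u v).map_add]; abel,
    fun c x => by dsimp only; rw [(hΦ u v).map_smul, (hΨ u v).map_smul, smul_add]⟩

theorem IsML.smul {Φ : List V → X} (hΦ : IsML k Φ) (c : k) : IsML k (fun w => c • Φ w) :=
  fun u v => ⟨fun x y => by dsimp only; rw [(hΦ u v).map_add, smul_add],
    fun d x => by dsimp only; rw [(hΦ u v).map_smul, smul_comm]⟩

theorem isLinearMap_add {Φ Ψ : V → X} (hΦ : IsLinearMap k Φ) (hΨ : IsLinearMap k Ψ) :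
    IsLinearMap k (fun w => Φ w + Ψ w) :=
  (hΦ.mk' Φ + hΨ.mk' Ψ).isLinear

theorem isLinearMap_comp {Φ : X → Y} {Ψ : V → X} (hΦ : IsLinearMap k Φ) (hΨ : IsLinearMap k Ψ) :
    IsLinearMap k (fun w => Φ (Ψ w)) :=
  ((hΦ.mk' Φ) ∘ₗ (hΨ.mk' Ψ)).isLinear

theorem isLinearMap_zero : IsLinearMap k (fun _ : V => (0 : X)) :=
  (0 : V →ₗ[k] X).isLinear

theorem isLinearMap_splitSum {H : V → List V → List V → X}
    (h : ∀ a c, IsLinearMap k (fun x => H x a c)) (w : List V) :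
    IsLinearMap k (fun x => splitSum (H x) w) := by
  induction w generalizing H with
  | nil => exact h [] []
  | cons x w ih => exact isLinearMap_add (h [] (x :: w)) (ih fun a c => h (x :: a) c)

/-- The sum of `Φ (f u₁, …, f u_l)` over all decompositions of `u ++ w` into non-empty words the
first of which has the prefix `u`. -/
def pullAux (f : List V → V) (Φ : List V → X) (u : List V) : List V → X
  | [] => Φ [f u]
  | x :: w => pullAux f Φ (u ++ [x]) w + pullAux f (fun v => Φ (f u :: v)) [x] w

/-- The sum of `Φ (f u₁, …, f u_l)` over all decompositions of `w` into non-empty words. -/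
def pull (f : List V → V) (Φ : List V → X) : List V → X
  | [] => Φ []
  | x :: w => pullAux f Φ [x] w

theorem pull_nil (f : List V → V) (Φ : List V → X) : pull f Φ [] = Φ [] := rfl

/-- Trades the recursion that grows a prefix for a sum over the end of the first block; `pull_cons`
is the form used afterwards. -/
theorem pullAux_eq (f : List V → V) (Φ : List V → X) (u w : List V) :
    pullAux f Φ u w = splitSum (fun a c => pull f (fun v => Φ (f (u ++ a) :: v)) c) w := by
  induction w generalizing Φ u with
  | nil => simp [pullAux, splitSum, pull]
  | cons x w ih =>
    rw [pullAux, ih (u := u ++ [x]), splitSum, add_comm]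
    simp [pull]

theorem pull_cons (f : List V → V) (Φ : List V → X) (x : V) (w : List V) :
    pull f Φ (x :: w) = splitSum (fun a c => pull f (fun v => Φ (f (x :: a) :: v)) c) w :=
  pullAux_eq f Φ [x] w

theorem pullAux_map (f : List V → V) {L : X → Y} (hL : IsLinearMap k L) (Φ : List V → X)
    (u w : List V) : pullAux f (fun v => L (Φ v)) u w = L (pullAux f Φ u w) := by
  induction w generalizing Φ u with
  | nil => rfl
  | cons x w ih => simp only [pullAux, hL.map_add, ih]

theorem pull_map (f : List V → V) {L : X → Y} (hL : IsLinearMap k L) (Φ : List V → X) (w : List V) :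
    pull f (fun v => L (Φ v)) w = L (pull f Φ w) := by
  cases w
  · rfl
  · exact pullAux_map f hL ..

theorem pullAux_add (f : List V → V) (Φ Ψ : List V → X) (u w : List V) :
    pullAux f (fun v => Φ v + Ψ v) u w = pullAux f Φ u w + pullAux f Ψ u w := by
  induction w generalizing Φ Ψ u with
  | nil => rfl
  | cons x w ih =>
    simp only [pullAux, ih]; abel

theorem pull_add (f : List V → V) (Φ Ψ : List V → X) (w : List V) :
    pull f (fun v => Φ v + Ψ v) w = pull f Φ w + pull f Ψ w := by
  cases w
  · rfl
  · exact pullAux_add ..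

theorem pullAux_smul (f : List V → V) (c : k) (Φ : List V → X) (u w : List V) :
    pullAux f (fun v => c • Φ v) u w = c • pullAux f Φ u w :=
  pullAux_map f (IsLinearMap.isLinearMap_smul c) Φ u w

theorem pull_zero (f : List V → V) (w : List V) : pull f (fun _ => (0 : X)) w = 0 := by
  simpa using pull_add f (fun _ => (0 : X)) (fun _ => 0) w

theorem isLinearMap_pullAux {f : List V → V} {Φ : V → List V → X}
    (h : ∀ v, IsLinearMap k (fun x => Φ x v)) (u w : List V) :
    IsLinearMap k (fun x => pullAux f (Φ x) u w) := by
  constructor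
  · intro x y
    rw [← pullAux_add]; exact congrArg (pullAux f · u w) (funext fun v => (h v).map_add x y)
  · intro c x
    rw [← pullAux_smul]; exact congrArg (pullAux f · u w) (funext fun v => (h v).map_smul c x)

theorem isLinearMap_pull {f : List V → V} {Φ : V → List V → X}
    (h : ∀ v, IsLinearMap k (fun x => Φ x v)) (w : List V) :
    IsLinearMap k (fun x => pull f (Φ x) w) := by
  cases w
  · exact h []
  · exact isLinearMap_pullAux h ..

theorem IsML.pullAux_prefix {f : List V → V} (hf : IsML k f) {Φ : List V → X} (hΦ : IsML k Φ)
    (u₁ u₂ w : List V) : IsLinearMap k (fun x => pullAux f Φ (u₁ ++ x :: u₂) w) := by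
  induction w generalizing u₂ with
  | nil => exact isLinearMap_comp (Φ := fun y => Φ [y]) (hΦ.head []) (hf u₁ u₂)
  | cons y w ih =>
    simp only [pullAux, List.append_assoc, List.cons_append]
    exact isLinearMap_add (ih (u₂ ++ [y]))
      (isLinearMap_comp (isLinearMap_pullAux (fun v => hΦ.head v) [y] w) (hf u₁ u₂))

theorem IsML.pullAux_word {f : List V → V} (hf : IsML k f) {Φ : List V → X} (hΦ : IsML k Φ)
    (u w₁ w₂ : List V) : IsLinearMap k (fun x => pullAux f Φ u (w₁ ++ x :: w₂)) := by
  induction w₁ generalizing u Φ with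
  | nil =>
    exact isLinearMap_add (hf.pullAux_prefix hΦ u [] w₂) (hf.pullAux_prefix (hΦ.tail _) [] [] w₂)
  | cons y w ih => exact isLinearMap_add (ih hΦ _) (ih (hΦ.tail _) _)

theorem IsML.pull {f : List V → V} (hf : IsML k f) {Φ : List V → X} (hΦ : IsML k Φ) :
    IsML k (pull f Φ) := by
  rintro (_ | ⟨y, u⟩) v
  · exact hf.pullAux_prefix hΦ [] [] v
  · exact hf.pullAux_word hΦ [y] u v

/-- The map induced by `f` respects deconcatenation: cutting a list of blocks in two means cutting
the word at a block boundary and decomposing both parts independently. -/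
theorem pull_splitSum (f : List V → V) (H : List V → List V → X) (w : List V) :
    pull f (splitSum H) w =
      splitSum (fun a c => pull f (fun a' => pull f (H a') c) a) w := by
  induction hn : w.length using Nat.strong_induction_on generalizing H w with
  | _ n ih =>
  cases w with
  | nil => rfl
  | cons x w =>
    have key : ∀ a c, a ++ c = w →
        pull f (fun s => splitSum H (f (x :: a) :: s)) c =
          pull f (fun s => H [] (f (x :: a) :: s)) c +
          splitSum (fun a₂ c₂ => pull f (fun a' => pull f (H (f (x :: a) :: a')) c₂) a₂) c := by
      intro a c hac
      simp only [splitSum, pull_add]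
      rw [← ih c.length _ _ c rfl]
      simp only [← hn, ← hac, List.length_append, List.length_cons]; omega
    rw [pull_cons, splitSum_congr w key, splitSum_add,
      splitSum_assoc (fun a a₂ c₂ => pull f (fun a' => pull f (H (f (x :: a) :: a')) c₂) a₂),
      splitSum, pull_nil, pull_cons]
    simp only [pull_cons]

/-- Empty first blocks may be admitted because `f [] = 0` kills them. The recursion then is a
`splitSum` for every word, so that `pull_splitSum` and `ins_splitSum` apply to it. -/
theorem pull_eq {f : List V → V} (hf : f [] = 0) {Φ : List V → X} (hΦ : IsML k Φ) (w : List V) :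
    pull f Φ w = (if w = [] then Φ [] else 0) +
      splitSum (fun a c => pull f (fun v => Φ (f a :: v)) c) w := by
  cases w with
  | nil => simp [splitSum, pull_nil, hf, hΦ.zero_cons]
  | cons x w => simp [splitSum, hf, hΦ.zero_cons, pull_zero, pull_cons, splitSum_zero]

theorem pull_cons_of_nil (f : List V → V) {Φ : List V → X} (h : ∀ x w, Φ (x :: w) = 0) (x : V)
    (w : List V) : pull f Φ (x :: w) = 0 := by
  simp [pull_cons, h, pull_zero, splitSum_zero]

theorem pull_pull (f : List V → V) {g : List V → V} (hg : g [] = 0) {Φ : List V → X}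
    (hΦ : IsML k Φ) (w : List V) : pull f (pull g Φ) w = pull (pull f g) Φ w := by
  induction hn : w.length using Nat.strong_induction_on generalizing Φ w with
  | _ n ih =>
  cases w with
  | nil => rfl
  | cons x w =>
    rw [funext (pull_eq hg hΦ), pull_add, pull_cons_of_nil _ (by simp), zero_add, pull_splitSum,
      splitSum, pull_nil, hg]
    simp only [hΦ.zero_cons, pull_zero, zero_add]
    rw [pull_cons]
    refine splitSum_congr w fun a c hac => ?_
    have hc : c.length < n := by
      simp only [← hn, ← hac, List.length_append, List.length_cons]; omega
    simp only [fun y => ih c.length hc (hΦ.tail y) c rfl]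
    -- The first block of `g` enters linearly, so the sum over the `f`-decompositions of the letters
    -- below it can be collected into `pull f g`.
    exact pull_map f (isLinearMap_pull (f := pull f g) (Φ := fun y v => Φ (y :: v))
      (fun v => hΦ.head v) c) g (x :: a)

/-- The word function of the identity morphism. -/
def idWord : List V → V
  | [x] => x
  | _ => 0

theorem idWord_nil : idWord ([] : List V) = 0 := rfl

theorem idWord_singleton (x : V) : idWord [x] = x := rfl

theorem idWord_cons_cons (x y : V) (w : List V) : idWord (x :: y :: w) = 0 := rfl

theorem IsML.idWord : IsML k (idWord : List V → V) := by
  rintro (_ | ⟨y, _ | ⟨z, u⟩⟩) (_ | ⟨t, v⟩)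
  · exact IsLinearMap.mk (fun _ _ => rfl) (fun _ _ => rfl)
  all_goals exact isLinearMap_zero

theorem splitSum_eq_head {H : List V → List V → X} (h : ∀ x a c, H (x :: a) c = 0) (w : List V) :
    splitSum H w = H [] w := by
  cases w with
  | nil => rfl
  | cons x w => simp only [splitSum, h, splitSum_zero, add_zero]

theorem pull_idWord_left {Φ : List V → X} (hΦ : IsML k Φ) (w : List V) :
    pull idWord Φ w = Φ w := by
  induction w generalizing Φ with
  | nil => rfl
  | cons x w ih =>
    rw [pull_cons, splitSum_eq_head, idWord_singleton]
    · exact ih (hΦ.tail x)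
    · intro y a c
      simp only [idWord_cons_cons, hΦ.zero_cons, pull_zero]

theorem splitSum_eq_last {H : List V → List V → X} (h : ∀ a x c, H a (x :: c) = 0) (w : List V) :
    splitSum H w = H w [] := by
  induction w generalizing H with
  | nil => rfl
  | cons x w ih => rw [splitSum, h, zero_add, ih]; intros; exact h _ _ _

theorem pull_idWord {f : List V → V} (hf : f [] = 0) (w : List V) : pull f idWord w = f w := by
  cases w with
  | nil => exact hf.symm
  | cons x w =>
    rw [pull_cons, splitSum_eq_last]
    · rfl
    · intro a y c
      exact pull_cons_of_nil f (fun z v => idWord_cons_cons _ z v) y c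

/-! ### Insertion of an operation: the coderivation side -/

section Insertion

variable (τ : V →ₗ[k] V)

/-- The sum of `Φ (τ u, b v, t)` over all decompositions `w = u ++ v ++ t` with `v` non-empty. -/
def ins (b : List V → V) (Φ : List V → X) : List V → X
  | [] => 0
  | x :: w => ins b (fun v => Φ (τ x :: v)) w + splitSum (fun a c => Φ (b (x :: a) :: c)) w

variable {τ}

theorem ins_map (b : List V → V) {L : X → Y} (hL : IsLinearMap k L) (Φ : List V → X) (w : List V) :
    ins τ b (fun v => L (Φ v)) w = L (ins τ b Φ w) := by
  induction w generalizing Φ with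
  | nil => simp [ins, hL.map_zero]
  | cons x w ih =>
    simp only [ins, hL.map_add, ih (fun v => Φ (τ x :: v)), map_splitSum hL]

theorem ins_add (b : List V → V) (Φ Ψ : List V → X) (w : List V) :
    ins τ b (fun v => Φ v + Ψ v) w = ins τ b Φ w + ins τ b Ψ w := by
  induction w generalizing Φ Ψ with
  | nil => simp [ins]
  | cons x w ih =>
    simp only [ins, ih (fun v => Φ (τ x :: v)) (fun v => Ψ (τ x :: v)), splitSum_add]
    abel

theorem ins_smul (b : List V → V) (c : k) (Φ : List V → X) (w : List V) :
    ins τ b (fun v => c • Φ v) w = c • ins τ b Φ w :=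
  ins_map b (IsLinearMap.isLinearMap_smul c) Φ w

theorem ins_zero (b : List V → V) (w : List V) : ins τ b (fun _ => (0 : X)) w = 0 := by
  simpa using ins_add (τ := τ) b (fun _ => (0 : X)) (fun _ => 0) w

theorem ins_of_nil (b : List V → V) {Φ : List V → X} (h : ∀ x w, Φ (x :: w) = 0) (w : List V) :
    ins τ b Φ w = 0 := by
  cases w with
  | nil => rfl
  | cons x w => simp only [ins, h, ins_zero, splitSum_zero, add_zero]

theorem isLinearMap_ins {b : List V → V} {Φ : V → List V → X}
    (h : ∀ v, IsLinearMap k (fun x => Φ x v)) (w : List V) :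
    IsLinearMap k (fun x => ins τ b (Φ x) w) := by
  constructor
  · intro x y
    rw [← ins_add]; exact congrArg (ins τ b · w) (funext fun v => (h v).map_add x y)
  · intro c x
    rw [← ins_smul]; exact congrArg (ins τ b · w) (funext fun v => (h v).map_smul c x)

theorem IsML.splitSum_word {H : List V → List V → X} (h₁ : ∀ c, IsML k (fun a => H a c))
    (h₂ : ∀ a, IsML k (H a)) : IsML k (splitSum H) := by
  intro u v
  induction u generalizing H with
  | nil =>
    exact isLinearMap_add (h₂ [] [] v) (isLinearMap_splitSum (fun a c => h₁ c [] a) v)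
  | cons y u ih =>
    exact isLinearMap_add (h₂ [] (y :: u) v) (ih (fun c => (h₁ c).tail y) (fun a => h₂ (y :: a)))

theorem IsML.ins {b : List V → V} (hb : IsML k b) {Φ : List V → X} (hΦ : IsML k Φ) :
    IsML k (ins τ b Φ) := by
  intro u v
  induction u generalizing Φ with
  | nil =>
    exact isLinearMap_add
      (isLinearMap_comp (isLinearMap_ins (fun v => hΦ.head v) v) τ.isLinear)
      (isLinearMap_splitSum (fun a c => isLinearMap_comp (Φ := fun z => Φ (z :: c)) (hΦ.head c)
        (hb [] a)) v)
  | cons y u ih =>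
    refine isLinearMap_add (ih (hΦ.tail _)) ?_
    exact IsML.splitSum_word (H := fun a c => Φ (b (y :: a) :: c))
      (fun c u v => isLinearMap_comp (Φ := fun z => Φ (z :: c)) (hΦ.head c) (hb (y :: u) v))
      (fun a => hΦ.tail _) u v

/-- The coderivation property: `b` is inserted on one side of the cut, and if on the right, it has
passed the whole left part, which therefore receives `τ`. -/
theorem ins_splitSum (b : List V → V) (H : List V → List V → X) (w : List V) :
    ins τ b (splitSum H) w =
      splitSum (fun a c => ins τ b (fun a' => H a' c) a + ins τ b (H (a.map τ)) c) w := by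
  induction w generalizing H with
  | nil => simp [ins, splitSum]
  | cons x w ih =>
    simp only [ins, splitSum, ins_add, splitSum_add, ih, List.map_cons, List.map_nil]
    rw [splitSum_assoc (fun a a₁ a₂ => H (b (x :: a) :: a₁) a₂)]
    abel

/-- The part of `ins` in which the first letter is kept. -/
def insTail (τ : V →ₗ[k] V) (b : List V → V) (Φ : List V → X) : List V → X
  | [] => 0
  | x :: w => ins τ b (fun v => Φ (τ x :: v)) w

theorem ins_eq {b : List V → V} (hb : b [] = 0) {Φ : List V → X} (hΦ : IsML k Φ) (w : List V) :
    ins τ b Φ w = splitSum (fun a c => Φ (b a :: c)) w + insTail τ b Φ w := by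
  cases w with
  | nil => simp [ins, splitSum, insTail, hb, hΦ.zero_cons]
  | cons x w => simp [ins, splitSum, insTail, hb, hΦ.zero_cons, add_comm]

/-- If `f` intertwines `b` and `b'`, then so does the substitution of `f` into any function. -/
theorem ins_pull {b b' f : List V → V} (hb' : b' [] = 0) (hf : f [] = 0)
    (hfτ : ∀ u, f (u.map τ) = τ (f u)) (h : ∀ w, pull f b' w = ins τ b f w)
    {Φ : List V → X} (hΦ : IsML k Φ) (w : List V) :
    ins τ b (pull f Φ) w = pull f (ins τ b' Φ) w := by
  induction hn : w.length using Nat.strong_induction_on generalizing Φ w with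
  | _ n ih =>
  cases w with
  | nil => rfl
  | cons x w =>
    have hlin := fun c => isLinearMap_pull (f := f) (Φ := fun y v => Φ (y :: v))
      (fun v => hΦ.head v) c
    rw [funext (pull_eq hf hΦ), ins_add, ins_of_nil _ (by simp), zero_add, ins_splitSum,
      splitSum_add, funext (ins_eq hb' hΦ), pull_add, pull_splitSum]
    -- Either `b` acts within the first block, where `h` applies, or to the right of it, where the
    -- induction hypothesis applies after `hfτ` has moved `τ` through `f`.
    congr 1
    · refine splitSum_congr _ fun a c _ => ?_
      refine (ins_map b (hlin c) f a).trans ?_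
      rw [← h]
      exact (pull_map f (hlin c) b' a).symm
    · rw [splitSum, pull_cons, List.map_nil, hf]
      simp only [hΦ.zero_cons, pull_zero, ins_zero, zero_add, hfτ, insTail]
      refine splitSum_congr _ fun a c hac => ?_
      refine ih c.length ?_ (hΦ.tail _) c rfl
      simp only [← hn, ← hac, List.length_append, List.length_cons]; omega

/-- Disjoint insertions cancel in pairs because `b` anticommutes with `τ`; nested ones add up to
`ins τ b b`, which is zero. -/
theorem ins_ins {b : List V → V} (hb : b [] = 0) (hbτ : ∀ u, b (u.map τ) = -τ (b u))
    (h : ∀ w, ins τ b b w = 0) {Φ : List V → X} (hΦ : IsML k Φ) (w : List V) :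
    ins τ b (ins τ b Φ) w = 0 := by
  induction w generalizing Φ with
  | nil => rfl
  | cons x w ih =>
    have key : splitSum (fun a c => ins τ b (fun v => Φ (b (a.map τ) :: v)) c) (x :: w) =
        -splitSum (fun a c => ins τ b (fun v => Φ (τ (b (x :: a)) :: v)) c) w := by
      have hn : IsLinearMap k (fun y : X => -y) := IsLinearMap.isLinearMap_neg
      rw [← map_splitSum hn, splitSum, List.map_nil, hb]
      simp only [hΦ.zero_cons, ins_zero, zero_add, hbτ, (hΦ.head _).map_neg, ins_map b hn]
    have key' : ∀ a c, ins τ b (fun a' => Φ (b a' :: c)) a = 0 := fun a c =>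
      (ins_map b (hΦ.head c) b a).trans (by rw [h, (hΦ.head c).map_zero])
    rw [funext (ins_eq hb hΦ), ins_add, ins_splitSum]
    simp only [key', zero_add, key]
    simp only [ins, insTail, ih (hΦ.tail _), zero_add, neg_add_cancel]

end Insertion

end Words

/-! ### Inverses under substitution -/

section Words

variable {k : Type*} [Field k] {V : Type*} [AddCommGroup V] [Module k V]
variable {X : Type*} [AddCommGroup X] [Module k X]

theorem pullAux_congr (f : List V → V) {Φ Ψ : List V → X} (u w : List V)
    (h : ∀ v, v.length ≤ w.length + 1 → Φ v = Ψ v) : pullAux f Φ u w = pullAux f Ψ u w := by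
  induction w generalizing Φ Ψ u with
  | nil => exact h _ le_rfl
  | cons x w ih =>
    rw [pullAux, pullAux, ih _ fun v hv => h v (by simp; omega),
      ih [x] (Φ := fun v => Φ (f u :: v)) fun v hv => h _ (by simp; omega)]

theorem pull_congr (f : List V → V) {Φ Ψ : List V → X} (w : List V)
    (h : ∀ v, v.length ≤ w.length → Φ v = Ψ v) : pull f Φ w = pull f Ψ w := by
  cases w with
  | nil => exact h [] le_rfl
  | cons x w => exact pullAux_congr f _ w h

/-- All decompositions other than the one into single letters have fewer blocks than letters and are
killed by `Φ`. -/
theorem pull_eq_self {f : List V → V} (hf : ∀ x, f [x] = x) {Φ : List V → X} (w : List V)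
    (h : ∀ v, v.length < w.length → Φ v = 0) : pull f Φ w = Φ w := by
  induction hn : w.length using Nat.strong_induction_on generalizing Φ w with
  | _ n ih =>
  cases w with
  | nil => rfl
  | cons x w =>
    have hw : w.length < n := by simp [← hn]
    have key : ∀ c y, c.length ≤ w.length → pull f (fun v => Φ (y :: v)) c = Φ (y :: c) :=
      fun c y hc => ih c.length (by omega) c (fun v hv => h _ (by simp; omega)) rfl
    rw [pull_cons, splitSum_congr w (H' := fun a c => Φ (f (x :: a) :: c))
      (fun a c hac => key c _ (by simp [← hac])), splitSum_eq_sum,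
      Finset.sum_eq_single_of_mem 0 (by simp)]
    · simp [hf]
    · intro i hi hi0
      refine h _ ?_
      simp at hi ⊢
      omega

theorem IsML.sub {Φ Ψ : List V → X} (hΦ : IsML k Φ) (hΨ : IsML k Ψ) :
    IsML k (fun w => Φ w - Ψ w) := by
  simpa [sub_eq_add_neg] using hΦ.add (hΨ.smul (-1))

/-- Successive approximations to the inverse of `f`. -/
def invSeq (f : List V → V) : ℕ → List V → V
  | 0 => idWord
  | n + 1 => fun w => invSeq f n w + (idWord w - pull f (invSeq f n) w)

/-- The word function `g` with `pull f g = idWord`. -/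
def invWord (f : List V → V) (w : List V) : V := invSeq f w.length w

/-- Adding the error to the approximation changes `pull f` by exactly that error in the first length
where it can be non-zero (`pull_eq_self`), so each step gains one length. -/
theorem idWord_sub_pull_invSeq {f : List V → V} (h0 : f [] = 0) (h1 : ∀ x, f [x] = x) (n : ℕ)
    (w : List V) (hw : w.length < n + 2) : idWord w - pull f (invSeq f n) w = 0 := by
  induction n generalizing w with
  | zero =>
    rw [invSeq, pull_idWord h0]
    match w, hw with
    | [], _ => simp [h0, idWord_nil]
    | [x], _ => simp [h1, idWord_singleton]
    | _ :: _ :: _, hw => simp at hw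
  | succ n ih =>
    rw [invSeq, pull_add, ← sub_sub, pull_eq_self h1 w fun v hv => ih v (by omega), sub_self]

theorem invSeq_eq {f : List V → V} (h0 : f [] = 0) (h1 : ∀ x, f [x] = x) {n : ℕ} {w : List V}
    (hw : w.length ≤ n) : invSeq f n w = invWord f w := by
  induction n with
  | zero =>
    obtain rfl : w = [] := by simpa using hw
    rfl
  | succ n ih =>
    rcases hw.lt_or_eq with h | h
    · simp only [invSeq]
      rw [idWord_sub_pull_invSeq h0 h1 n w (by omega), add_zero, ih (by omega)]
    · rw [invWord, h]

theorem pull_invWord {f : List V → V} (h0 : f [] = 0) (h1 : ∀ x, f [x] = x) (w : List V) :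
    pull f (invWord f) w = idWord w := by
  rw [pull_congr f w fun v hv => (invSeq_eq h0 h1 hv).symm]
  exact (sub_eq_zero.1 (idWord_sub_pull_invSeq h0 h1 _ w (by omega))).symm

theorem invWord_nil (f : List V → V) : invWord f [] = 0 := rfl

theorem invWord_singleton {f : List V → V} (h1 : ∀ x, f [x] = x) (x : V) :
    invWord f [x] = x := by
  simp only [invWord, List.length_singleton, invSeq, idWord_singleton, pull, pullAux, h1]
  simp

theorem IsML.invWord {f : List V → V} (hf : IsML k f) : IsML k (invWord f) := by
  have h : ∀ n, IsML k (invSeq f n) := fun n => by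
    induction n with
    | zero => exact IsML.idWord
    | succ n ih => exact ih.add (IsML.idWord.sub (hf.pull ih))
  intro u v
  have e : (fun x => AInf.invWord f (u ++ x :: v)) =
      fun x => invSeq f (u.length + (v.length + 1)) (u ++ x :: v) := by
    funext x; simp [AInf.invWord]
  rw [e]
  exact h _ u v

/-- The left inverse is also a right inverse. -/
theorem pull_invWord_left {f : List V → V} (h0 : f [] = 0) (h1 : ∀ x, f [x] = x) (hf : IsML k f)
    (w : List V) : pull (invWord f) f w = idWord w := by
  have hg := pull_invWord (f := invWord f) (invWord_nil f) (invWord_singleton h1)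
  -- If h ∘ g and g ∘ f are both the identity, then h = f; here g is `invWord f` and h is `invWord
  -- (invWord f)`.
  have : f = invWord (invWord f) := by
    funext w
    rw [← pull_idWord h0, ← funext hg, pull_pull (k := k) f (invWord_nil f) hf.invWord.invWord,
      funext (pull_invWord h0 h1), pull_idWord_left (k := k) hf.invWord.invWord]
  exact (congrArg (pull (invWord f) · w) this).trans (hg w)

end Words

/-! ### Koszul signs and parity of degrees -/

section Koszul

variable {k : Type*} [Field k] {N : ℕ} {V : Type*} [AddCommGroup V] [Module k V]
variable (𝒜 : ZMod N → Submodule k V) [DirectSum.Decomposition 𝒜]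
variable {W : Type*} [AddCommGroup W] [Module k W]
variable (ℬ : ZMod N → Submodule k W) [DirectSum.Decomposition ℬ]

variable {𝒜} in
theorem linearMap_ext_homogeneous {L L' : V →ₗ[k] W} (h : ∀ d, ∀ x ∈ 𝒜 d, L x = L' x) :
    L = L' := by
  ext x
  induction x using DirectSum.Decomposition.inductionOn 𝒜 with
  | zero => simp
  | homogeneous x => exact h _ _ x.2
  | add x y hx hy => simp [hx, hy]

theorem koszul_koszul (p q : ℤ) (x : V) : koszul 𝒜 p (koszul 𝒜 q x) = koszul 𝒜 (p + q) x := by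
  suffices h : koszul 𝒜 p ∘ₗ koszul 𝒜 q = koszul 𝒜 (p + q) from LinearMap.congr_fun h x
  refine linearMap_ext_homogeneous (𝒜 := 𝒜) fun d x hx => ?_
  rw [LinearMap.comp_apply, koszul_of_mem 𝒜 q hx, map_smul, koszul_of_mem 𝒜 p hx,
    koszul_of_mem 𝒜 _ hx, smul_smul, ← pow_add]
  congr 1
  refine neg_one_pow_congr ?_
  simp only [← add_mul, Nat.even_mul, Nat.even_add, Int.natAbs_even, Int.even_add]
  tauto

theorem koszul_congr {p q : ℤ} (h : Even p ↔ Even q) : koszul 𝒜 p = koszul 𝒜 q := by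
  refine linearMap_ext_homogeneous (𝒜 := 𝒜) fun d x hx => ?_
  rw [koszul_of_mem 𝒜 q hx, koszul_of_mem 𝒜 p hx]
  congr 1
  refine neg_one_pow_congr ?_
  simp only [Nat.even_mul, Int.natAbs_even, h]

theorem koszul_of_even {p : ℤ} (h : Even p) (x : V) : koszul 𝒜 p x = x := by
  rw [koszul_congr 𝒜 (q := 0) (by simpa using h)]
  suffices h : koszul 𝒜 0 = LinearMap.id from LinearMap.congr_fun h x
  refine linearMap_ext_homogeneous (𝒜 := 𝒜) fun d x hx => ?_
  simp [koszul_of_mem 𝒜 0 hx]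

variable {𝒜} in
theorem koszul_mem (p : ℤ) {d : ZMod N} {x : V} (hx : x ∈ 𝒜 d) : koszul 𝒜 p x ∈ 𝒜 d := by
  rw [koszul_of_mem 𝒜 p hx]
  exact Submodule.smul_mem _ _ hx

/-- Reduction modulo an even `N` preserves parity, which makes signs on a `ZMod N`-grading additive
in the degree. For `N = 0` the value is the absolute value. -/
theorem even_val_intCast (hN : Even N) (z : ℤ) : Even (z : ZMod N).val ↔ Even z := by
  rcases N.eq_zero_or_pos with rfl | h
  · exact Int.natAbs_even
  · have : NeZero N := ⟨h.ne'⟩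
    rw [← Int.even_coe_nat, ZMod.val_intCast, Int.even_iff, Int.even_iff,
      Int.emod_emod_of_dvd _ (by exact_mod_cast hN.two_dvd)]

theorem even_val_add (hN : Even N) (a b : ZMod N) :
    Even (a + b).val ↔ (Even a.val ↔ Even b.val) := by
  obtain ⟨a, rfl⟩ := ZMod.intCast_surjective a
  obtain ⟨b, rfl⟩ := ZMod.intCast_surjective b
  rw [← Int.cast_add]
  simp only [even_val_intCast hN, Int.even_add]

theorem neg_one_pow_val_sum (hN : Even N) {n : ℕ} (q : ℕ) (d : Fin n → ZMod N) :
    ((-1 : k) ^ (q * (∑ i, d i).val)) = ∏ i, (-1 : k) ^ (q * (d i).val) := by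
  induction n with
  | zero => simp
  | succ n ih =>
    rw [Fin.sum_univ_succ, Fin.prod_univ_succ, ← ih, ← pow_add, ← mul_add]
    refine neg_one_pow_congr ?_
    simp only [Nat.even_mul, Nat.even_add, even_val_add hN]

-- Bases of the graded pieces assemble into a basis of `V`, and a multilinear map is determined by
-- its values on a basis.
variable {𝒜 ℬ} in
theorem multilinearMap_ext_homogeneous {n : ℕ} {φ ψ : MultilinearMap k (fun _ : Fin n => V) W}
    (h : ∀ (d : Fin n → ZMod N) (a : Fin n → V), (∀ i, a i ∈ 𝒜 (d i)) → φ a = ψ a) : φ = ψ := by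
  have hI := DirectSum.Decomposition.isInternal 𝒜
  refine Module.Basis.ext_multilinear
    (fun _ => hI.collectedBasis fun d => Module.Basis.ofVectorSpace k (𝒜 d)) fun v => ?_
  exact h (fun i => (v i).1) _ fun i => hI.collectedBasis_mem _ _

-- On homogeneous arguments the degree of the value is the sum of their degrees plus `p`; only `p`
-- is missed by the signs on the arguments.
variable {𝒜 ℬ} in
theorem IsHomogeneous.koszul_apply (hN : Even N) {n : ℕ}
    {φ : MultilinearMap k (fun _ : Fin n => V) W} {p : ℤ} (hφ : IsHomogeneous 𝒜 ℬ φ p) (q : ℤ)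
    (a : Fin n → V) :
    koszul ℬ q (φ a) = ((-1 : k) ^ (q * p).natAbs) • φ (fun i => koszul 𝒜 q (a i)) := by
  suffices h : (koszul ℬ q).compMultilinearMap φ =
      ((-1 : k) ^ (q * p).natAbs) • φ.compLinearMap (fun _ => koszul 𝒜 q) from
    congrArg (fun ψ => ψ a) h
  refine multilinearMap_ext_homogeneous (𝒜 := 𝒜) fun d a ha => ?_
  have e : (fun i => koszul 𝒜 q (a i)) = fun i => ((-1 : k) ^ (q.natAbs * (d i).val)) • a i :=
    funext fun i => koszul_of_mem 𝒜 q (ha i)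
  simp only [LinearMap.compMultilinearMap_apply, _root_.smul_apply,
    MultilinearMap.compLinearMap_apply, e, MultilinearMap.map_smul_univ,
    koszul_of_mem ℬ q (hφ d a ha), smul_smul]
  rw [← neg_one_pow_val_sum hN, ← pow_add]
  congr 1
  refine neg_one_pow_congr ?_
  simp only [Nat.even_mul, Nat.even_add, even_val_add hN, even_val_intCast hN, Int.natAbs_even,
    Int.even_mul]
  tauto

end Koszul

/-! ### Shifting degrees: families of multilinear maps as functions on words -/

section Shift

variable {k : Type*} [Field k] {N : ℕ} {V : Type*} [AddCommGroup V] [Module k V]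
variable (𝒜 : ZMod N → Submodule k V) [DirectSum.Decomposition 𝒜]
variable {X : Type*} [AddCommGroup X] [Module k X]

theorem ofFn_update {n : ℕ} [DecidableEq (Fin n)] (a : Fin n → V) (i : Fin n) (x : V) :
    List.ofFn (Function.update a i x) =
      (List.ofFn a).take i ++ x :: (List.ofFn a).drop (i + 1) := by
  have h := List.set_eq_take_append_cons_drop (l := List.ofFn a) (i := i) (a := x)
  rw [if_pos (by simp)] at h
  rw [← h]
  refine List.ext_getElem (by simp) fun j h₁ h₂ => ?_
  simp only [List.getElem_ofFn, List.getElem_set, Function.update_apply, Fin.ext_iff, eq_comm]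

/-- The components of a multilinear function on words. -/
def toML (Φ : List V → X) (h : IsML k Φ) (n : ℕ) : MultilinearMap k (fun _ : Fin n => V) X where
  toFun a := Φ (List.ofFn a)
  map_update_add' a i x y := by simp only [ofFn_update, (h _ _).map_add]
  map_update_smul' a i c x := by simp only [ofFn_update, (h _ _).map_smul]

/-- The operator `x ↦ (-1)^{|x| - 1} x`. -/
noncomputable def tau : V →ₗ[k] V := -koszul 𝒜 1

theorem tau_apply (x : V) : tau 𝒜 x = -koszul 𝒜 1 x := rfl

variable {𝒜} in
theorem tau_mem {d : ZMod N} {x : V} (hx : x ∈ 𝒜 d) : tau 𝒜 x ∈ 𝒜 d :=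
  Submodule.neg_mem _ (koszul_mem 1 hx)

/-- The word function obtained from a family of multilinear maps by shifting the degrees of the
arguments by one. -/
noncomputable def shift (f : ∀ n : ℕ, MultilinearMap k (fun _ : Fin n => V) X) (w : List V) : X :=
  ((-1 : k) ^ w.length.choose 2) •
    f w.length (fun i => koszul 𝒜 ((w.length : ℤ) - 1 - i) (w.getD i 0))

theorem shift_of_length (f : ∀ n : ℕ, MultilinearMap k (fun _ : Fin n => V) X) {w : List V} {n : ℕ}
    (h : w.length = n) : shift 𝒜 f w =
      ((-1 : k) ^ n.choose 2) • f n (fun i => koszul 𝒜 ((n : ℤ) - 1 - i) (w.getD i 0)) := by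
  subst h; rfl

theorem shift_nil {f : ∀ n : ℕ, MultilinearMap k (fun _ : Fin n => V) X} (h : f 0 = 0) :
    shift 𝒜 f [] = 0 := by
  rw [shift_of_length 𝒜 f (n := 0) rfl, h]; simp

theorem isML_shift (f : ∀ n : ℕ, MultilinearMap k (fun _ : Fin n => V) X) :
    IsML k (shift 𝒜 f) := by
  intro u v
  set n := u.length + (v.length + 1) with hn
  let j : Fin n := ⟨u.length, by omega⟩
  have e : ∀ x : V, (fun i : Fin n => koszul 𝒜 ((n : ℤ) - 1 - i) ((u ++ x :: v).getD i 0)) =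
      Function.update (fun i : Fin n => koszul 𝒜 ((n : ℤ) - 1 - i) ((u ++ 0 :: v).getD i 0)) j
        (koszul 𝒜 ((n : ℤ) - 1 - j) x) := by
    intro x
    funext i
    by_cases hi : i = j
    · subst hi; simp [j]
    · have hi' : (i : ℕ) ≠ u.length := fun h => hi (Fin.ext h)
      rw [Function.update_of_ne hi]
      congr 1
      rcases lt_or_gt_of_ne hi' with h | h
      · rw [List.getD_append _ _ _ _ h, List.getD_append _ _ _ _ h]
      · obtain ⟨m, hm⟩ := Nat.exists_eq_add_of_lt h
        rw [List.getD_append_right _ _ _ _ h.le, List.getD_append_right _ _ _ _ h.le,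
          show (i : ℕ) - u.length = m + 1 by omega]
        rfl
  have e' : (fun x => shift 𝒜 f (u ++ x :: v)) = fun x => ((-1 : k) ^ n.choose 2) •
      f n (Function.update (fun i : Fin n => koszul 𝒜 ((n : ℤ) - 1 - i) ((u ++ 0 :: v).getD i 0)) j
        (koszul 𝒜 ((n : ℤ) - 1 - j) x)) := by
    funext x
    rw [shift_of_length 𝒜 f (n := n) (by simp [hn]), e]
  rw [e']
  constructor
  · intro x y; rw [map_add, MultilinearMap.map_update_add, smul_add]
  · intro c x; rw [map_smul, MultilinearMap.map_update_smul, smul_comm]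

/-- The family of multilinear maps with a given shift. -/
noncomputable def unshift (Φ : List V → X) (h : IsML k Φ) (n : ℕ) :
    MultilinearMap k (fun _ : Fin n => V) X :=
  ((-1 : k) ^ n.choose 2) •
    (toML Φ h n).compLinearMap (fun i => koszul 𝒜 ((n : ℤ) - 1 - i))

theorem neg_one_pow_mul_self (n : ℕ) : (-1 : k) ^ n * (-1) ^ n = 1 := by
  rw [← mul_pow]; simp

theorem ofFn_getD (w : List V) : List.ofFn (fun i : Fin w.length => w.getD i 0) = w :=
  List.ext_getElem (by simp) fun i h₁ _ => by simp

theorem shift_unshift (Φ : List V → X) (h : IsML k Φ) : shift 𝒜 (unshift 𝒜 Φ h) = Φ := by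
  funext w
  simp only [shift, unshift, _root_.smul_apply, MultilinearMap.compLinearMap_apply, smul_smul,
    neg_one_pow_mul_self, one_smul, koszul_koszul]
  simp only [koszul_of_even 𝒜 (Even.add_self _)]
  exact congrArg Φ (ofFn_getD w)

/-- The word of length `n` at which a shifted family takes its values on `a₁, …, aₙ`, up to sign. -/
noncomputable def shiftSeq (n : ℕ) (a : ℕ → V) : List V :=
  List.ofFn (fun i : Fin n => koszul 𝒜 ((n : ℤ) - 1 - i) (a i))

theorem length_shiftSeq (n : ℕ) (a : ℕ → V) : (shiftSeq 𝒜 n a).length = n := by simp [shiftSeq]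

theorem getD_shiftSeq {n : ℕ} (a : ℕ → V) {i : ℕ} (hi : i < n) :
    (shiftSeq 𝒜 n a).getD i 0 = koszul 𝒜 ((n : ℤ) - 1 - i) (a i) := by
  simp [shiftSeq, hi]

theorem shift_shiftSeq (f : ∀ n : ℕ, MultilinearMap k (fun _ : Fin n => V) X) (n : ℕ) (a : ℕ → V) :
    shift 𝒜 f (shiftSeq 𝒜 n a) = ((-1 : k) ^ n.choose 2) • f n (fun i => a i) := by
  rw [shift_of_length 𝒜 f (length_shiftSeq 𝒜 n a)]
  congr 2
  funext i
  rw [getD_shiftSeq 𝒜 a i.2, koszul_koszul, koszul_of_even 𝒜 (Even.add_self _)]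

theorem apply_eq_shift (f : ∀ n : ℕ, MultilinearMap k (fun _ : Fin n => V) X) (n : ℕ) (a : ℕ → V) :
    f n (fun i => a i) = ((-1 : k) ^ n.choose 2) • shift 𝒜 f (shiftSeq 𝒜 n a) := by
  rw [shift_shiftSeq, smul_smul, neg_one_pow_mul_self, one_smul]

theorem exists_seq {n : ℕ} (a : Fin n → V) : ∃ b : ℕ → V, a = fun i : Fin n => b i :=
  ⟨fun i => if h : i < n then a ⟨i, h⟩ else 0, by funext i; simp⟩

/-- Every word is of the form `shiftSeq 𝒜 n a`. -/
theorem exists_shiftSeq (w : List V) : ∃ a : ℕ → V, w = shiftSeq 𝒜 w.length a := by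
  refine ⟨fun i => koszul 𝒜 ((w.length : ℤ) - 1 - i) (w.getD i 0), ?_⟩
  simp only [shiftSeq, koszul_koszul, koszul_of_even 𝒜 (Even.add_self _)]
  exact (ofFn_getD w).symm

theorem multilinear_eq_of_shift_eq {f g : ∀ n : ℕ, MultilinearMap k (fun _ : Fin n => V) X} {n : ℕ}
    (h : ∀ w : List V, w.length = n → shift 𝒜 f w = shift 𝒜 g w) : f n = g n := by
  ext a
  obtain ⟨b, rfl⟩ := exists_seq a
  rw [apply_eq_shift 𝒜 f, apply_eq_shift 𝒜 g, h _ (length_shiftSeq 𝒜 n b)]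

theorem shift_congr {f g : ∀ n : ℕ, MultilinearMap k (fun _ : Fin n => V) X} {w : List V}
    (h : f w.length = g w.length) : shift 𝒜 f w = shift 𝒜 g w := by
  rw [shift, shift, h]

theorem shift_eq_zero {f : ∀ n : ℕ, MultilinearMap k (fun _ : Fin n => V) X} {w : List V}
    (h : f w.length = 0) : shift 𝒜 f w = 0 := by
  rw [shift, h]; simp

theorem eq_zero_of_shift {f : ∀ n : ℕ, MultilinearMap k (fun _ : Fin n => V) X} {n : ℕ}
    (h : ∀ w : List V, w.length = n → shift 𝒜 f w = 0) : f n = 0 :=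
  multilinear_eq_of_shift_eq 𝒜 (g := fun _ => 0) fun w hw => by rw [h w hw, shift_eq_zero]; rfl

theorem shift_idMaps : shift 𝒜 (idMaps k V) = idWord := by
  funext w
  match w with
  | [] => exact shift_nil 𝒜 rfl
  | [x] =>
    rw [shift_of_length 𝒜 _ (n := 1) rfl]
    simp [idMaps, idWord_singleton, koszul_of_even]
  | x :: y :: w => exact shift_eq_zero 𝒜 rfl

/-! ### Homogeneous word functions -/

variable {𝒜}

/-- `Φ` is homogeneous of degree `c - 1` with respect to the grading shifted by one. -/
def IsHg (𝒜 : ZMod N → Submodule k V) (Φ : List V → V) (c : ZMod N) : Prop :=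
  ∀ w ds, List.Forall₂ (fun x d => x ∈ 𝒜 d) w ds → Φ w ∈ 𝒜 ((ds.map (· - 1)).sum + c)

theorem IsHg.tail {Φ : List V → V} {c : ZMod N} (h : IsHg 𝒜 Φ c) {y : V} {d : ZMod N}
    (hy : y ∈ 𝒜 d) : IsHg 𝒜 (fun w => Φ (y :: w)) (d - 1 + c) := fun w ds hw => by
  have := h (y :: w) (d :: ds) (.cons hy hw)
  convert this using 2
  simp; ring

theorem IsHg.add {Φ Ψ : List V → V} {c : ZMod N} (hΦ : IsHg 𝒜 Φ c) (hΨ : IsHg 𝒜 Ψ c) :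
    IsHg 𝒜 (fun w => Φ w + Ψ w) c :=
  fun w ds hw => Submodule.add_mem _ (hΦ w ds hw) (hΨ w ds hw)

theorem IsHg.sub {Φ Ψ : List V → V} {c : ZMod N} (hΦ : IsHg 𝒜 Φ c) (hΨ : IsHg 𝒜 Ψ c) :
    IsHg 𝒜 (fun w => Φ w - Ψ w) c :=
  fun w ds hw => Submodule.sub_mem _ (hΦ w ds hw) (hΨ w ds hw)

theorem IsHg.pullAux {f : List V → V} (hf : IsHg 𝒜 f 1) {Φ : List V → V} {c : ZMod N}
    (hΦ : IsHg 𝒜 Φ c) {u : List V} {du : List (ZMod N)}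
    (hu : List.Forall₂ (fun x d => x ∈ 𝒜 d) u du) {w : List V} {dw : List (ZMod N)}
    (hw : List.Forall₂ (fun x d => x ∈ 𝒜 d) w dw) :
    pullAux f Φ u w ∈ 𝒜 (((du ++ dw).map (· - 1)).sum + c) := by
  induction hw generalizing Φ c u du with
  | nil =>
    have : AInf.pullAux f Φ u [] ∈ _ := hΦ.tail (hf u du hu) [] [] .nil
    convert this using 2
    simp
  | @cons x d w dw hx hw ih =>
    refine Submodule.add_mem _ ?_ ?_
    · have := ih hΦ (List.rel_append hu (.cons hx .nil))
      simpa using this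
    · have := ih (hΦ.tail (hf u du hu)) (.cons hx .nil)
      convert this using 2
      simp; ring

theorem IsHg.pull {f : List V → V} (hf : IsHg 𝒜 f 1) {Φ : List V → V} {c : ZMod N}
    (hΦ : IsHg 𝒜 Φ c) : IsHg 𝒜 (pull f Φ) c := by
  intro w ds hw
  cases hw with
  | nil => exact hΦ [] [] .nil
  | cons hx hw => exact hf.pullAux hΦ (.cons hx .nil) hw

theorem splitSum_mem {H : List V → List V → V} {e : ZMod N}
    (h : ∀ a da c dc, List.Forall₂ (fun x d => x ∈ 𝒜 d) a da →
      List.Forall₂ (fun x d => x ∈ 𝒜 d) c dc → H a c ∈ 𝒜 (((da ++ dc).map (· - 1)).sum + e))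
    {w : List V} {ds : List (ZMod N)} (hw : List.Forall₂ (fun x d => x ∈ 𝒜 d) w ds) :
    splitSum H w ∈ 𝒜 ((ds.map (· - 1)).sum + e) := by
  induction hw generalizing H e with
  | nil => exact h [] [] [] [] .nil .nil
  | @cons x d w dw hx hw ih =>
    refine Submodule.add_mem _ (h [] [] _ (d :: dw) .nil (.cons hx hw)) ?_
    have := ih (H := fun a c => H (x :: a) c) (e := d - 1 + e) fun a da c dc ha hc => by
      have := h (x :: a) (d :: da) c dc (.cons hx ha) hc
      convert this using 2
      simp; ring
    convert this using 2
    simp; ring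

theorem IsHg.ins {b : List V → V} (hb : IsHg 𝒜 b 2) {Φ : List V → V} {c : ZMod N}
    (hΦ : IsHg 𝒜 Φ c) : IsHg 𝒜 (ins (tau 𝒜) b Φ) (c + 1) := by
  intro w ds hw
  induction hw generalizing Φ c with
  | nil => exact Submodule.zero_mem _
  | @cons x d w dw hx hw ih =>
    refine Submodule.add_mem _ ?_ ?_
    · have := ih (hΦ.tail (tau_mem hx))
      convert this using 2
      simp; ring
    · have := splitSum_mem (H := fun a c => Φ (b (x :: a) :: c)) (e := d - 1 + (c + 1))
        (fun a da e de ha he => ?_) hw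
      · convert this using 2
        simp; ring
      · have := hΦ.tail (hb (x :: a) (d :: da) (.cons hx ha)) e de he
        convert this using 2
        simp; ring

theorem IsHg.idWord : IsHg 𝒜 (idWord : List V → V) 1 := by
  intro w ds hw
  match hw with
  | .nil => exact Submodule.zero_mem _
  | .cons hx .nil => simpa [idWord_singleton] using hx
  | .cons _ (.cons _ _) => exact Submodule.zero_mem _

theorem IsHg.invWord {f : List V → V} (hf : IsHg 𝒜 f 1) : IsHg 𝒜 (invWord f) 1 := by
  have h : ∀ n, IsHg 𝒜 (invSeq f n) 1 := fun n => by
    induction n with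
    | zero => exact IsHg.idWord
    | succ n ih => exact ih.add (IsHg.idWord.sub (hf.pull ih))
  exact fun w => h w.length w

/-- Each argument absorbs one unit of the `-n` in the degree of `f n`, so all arities acquire the
same shifted degree. -/
theorem isHg_shift {f : ∀ n : ℕ, MultilinearMap k (fun _ : Fin n => V) V} {c : ℤ}
    (h : ∀ n : ℕ, IsHomogeneous 𝒜 𝒜 (f n) (c - n)) : IsHg 𝒜 (shift 𝒜 f) c := by
  intro w ds hw
  have hl := hw.length_eq
  refine Submodule.smul_mem _ _ ?_
  have := h w.length (fun i => ds.getD i 0)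
    (fun i => koszul 𝒜 ((w.length : ℤ) - 1 - i) (w.getD i 0)) fun i => koszul_mem _ ?_
  · convert this using 2
    have e : (∑ i : Fin w.length, ds.getD i 0) = ds.sum := by
      rw [hl, ← List.sum_ofFn]
      congr 1
      exact List.ext_getElem (by simp) fun i h₁ _ => by simp
    have e' : (ds.map (· - 1)).sum = ds.sum - ds.length := by
      clear * -
      induction ds with
      | nil => simp
      | cons d ds ih => simp [ih]; ring
    rw [e, e', hl]; push_cast; ring
  · have h₁ : (i : ℕ) < w.length := i.2
    have h₂ : (i : ℕ) < ds.length := hl ▸ i.2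
    have := hw.get h₁ h₂
    simpa [h₁, h₂] using this

theorem isHomogeneous_unshift {Φ : List V → V} {c : ℤ} (h : IsML k Φ) (hΦ : IsHg 𝒜 Φ c) (n : ℕ) :
    IsHomogeneous 𝒜 𝒜 (unshift 𝒜 Φ h n) (c - n) := by
  intro d a ha
  refine Submodule.smul_mem _ _ ?_
  have : (toML Φ h n).compLinearMap (fun i => koszul 𝒜 ((n : ℤ) - 1 - i)) a ∈ _ :=
    hΦ (List.ofFn fun i : Fin n => koszul 𝒜 ((n : ℤ) - 1 - i) (a i)) (List.ofFn d) ?_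
  · convert this using 2
    simp [List.map_ofFn, List.sum_ofFn]
    ring
  · rw [List.forall₂_iff_get]
    refine ⟨by simp, fun i h₁ h₂ => ?_⟩
    simpa using koszul_mem _ (ha ⟨i, by simpa using h₁⟩)

theorem isHomogeneous_zero (n : ℕ) (q : ℤ) :
    IsHomogeneous 𝒜 𝒜 (0 : MultilinearMap k (fun _ : Fin n => V) V) q :=
  fun _ _ _ => Submodule.zero_mem _

/-- All components have shifted degree `c - 1`, which is the sign for exchanging them with `tau`:
operations (`c = 2`) anticommute with it and morphisms (`c = 1`) commute. -/
theorem shift_map_tau (hN : Even N) {f : ∀ n : ℕ, MultilinearMap k (fun _ : Fin n => V) V} {c : ℤ}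
    (h : ∀ n : ℕ, IsHomogeneous 𝒜 𝒜 (f n) (c - n)) (w : List V) :
    shift 𝒜 f (w.map (tau 𝒜)) = ((-1 : k) ^ (c - 1).natAbs) • tau 𝒜 (shift 𝒜 f w) := by
  rw [shift_of_length 𝒜 f (w := w.map (tau 𝒜)) (n := w.length) (by simp), shift, map_smul,
    tau_apply, (h w.length).koszul_apply hN, smul_neg, smul_neg, smul_comm, ← smul_neg]
  congr 1
  have e : (fun i : Fin w.length => koszul 𝒜 ((w.length : ℤ) - 1 - i) ((w.map (tau 𝒜)).getD i 0)) =
      fun i : Fin w.length => (-1 : k) •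
        koszul 𝒜 1 (koszul 𝒜 ((w.length : ℤ) - 1 - i) (w.getD i 0)) := by
    funext i
    simp [tau_apply, koszul_koszul, add_comm]
  rw [e, MultilinearMap.map_smul_univ, smul_smul, ← neg_smul]
  congr 1
  rw [← pow_add, ← neg_one_mul ((-1 : k) ^ _), ← pow_succ', Finset.prod_const, Finset.card_univ,
    Fintype.card_fin]
  refine neg_one_pow_congr ?_
  simp only [Nat.even_add, Int.natAbs_even, Int.even_sub, one_mul, Int.even_coe_nat,
    Int.not_even_one, iff_false]
  tauto

end Shift

/-! ### Sign counts, and `ins` and `pull` as explicit sums -/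

theorem choose_two_add (a b : ℕ) : (a + b).choose 2 = a.choose 2 + b.choose 2 + a * b := by
  induction b with
  | zero => simp
  | succ b ih =>
    rw [← add_assoc, Nat.choose_succ_succ' (a + b) 1, Nat.choose_succ_succ' b 1, ih,
      Nat.choose_one_right, Nat.choose_one_right]
    ring

theorem choose_two_succ (a : ℕ) : (a + 1).choose 2 = a.choose 2 + a := by
  simp [choose_two_add]

/-- The sign count for composition, with blocks of size `u j + 1`. On the right stand the sign of
the outer shift, the signs of the inner shifts together with those for moving the outer parity
operators through the inner maps, and ♥. -/
theorem choose_two_sum (u : ℕ → ℕ) (l : ℕ) :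
    (∑ j ∈ Finset.range l, (u j + 1)).choose 2 =
      l.choose 2 + (∑ j ∈ Finset.range l, ((u j + 1).choose 2 + (l - 1 - j) * u j)) +
        ∑ j ∈ Finset.range l, u j * ∑ i ∈ Finset.range j, (u i + 1) := by
  induction l with
  | zero => simp
  | succ l ih =>
    have e : ∑ j ∈ Finset.range l, ((u j + 1).choose 2 + (l + 1 - 1 - j) * u j) =
        (∑ j ∈ Finset.range l, ((u j + 1).choose 2 + (l - 1 - j) * u j)) +
          ∑ j ∈ Finset.range l, u j := by
      rw [← Finset.sum_add_distrib]
      refine Finset.sum_congr rfl fun j hj => ?_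
      rw [Finset.mem_range] at hj
      rw [show l + 1 - 1 - j = (l - 1 - j) + 1 by omega]; ring
    have e' : ∑ j ∈ Finset.range l, (u j + 1) = (∑ j ∈ Finset.range l, u j) + l := by
      simp [Finset.sum_add_distrib]
    rw [Finset.sum_range_succ, Finset.sum_range_succ, Finset.sum_range_succ, choose_two_add, ih, e,
      choose_two_succ l, e', Nat.add_sub_cancel, Nat.sub_self]
    ring

section Words

variable {k : Type*} [Field k] {V : Type*} [AddCommGroup V] [Module k V]
variable {X : Type*} [AddCommGroup X] [Module k X]

theorem ins_eq_sum (τ : V →ₗ[k] V) (b : List V → V) (Φ : List V → X) (w : List V) :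
    ins τ b Φ w = ∑ r ∈ Finset.range w.length, ∑ i ∈ Finset.range (w.length - r),
      Φ ((w.take r).map τ ++ b ((w.drop r).take (i + 1)) :: w.drop (r + (i + 1))) := by
  induction w generalizing Φ with
  | nil => simp [ins]
  | cons x w ih =>
    rw [ins, ih, List.length_cons, Finset.sum_range_succ', splitSum_eq_sum]
    refine congrArg₂ (· + ·) (Finset.sum_congr rfl fun r _ => ?_) (by simp)
    rw [Nat.add_sub_add_right]
    refine Finset.sum_congr rfl fun i _ => ?_
    rw [show r + 1 + (i + 1) = r + (i + 1) + 1 by omega]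
    simp

theorem sum_composition (F : List ℕ → X) (n : ℕ) :
    ∑ c : Composition (n + 1), F c.blocks =
      ∑ i ∈ Finset.range (n + 1), ∑ c : Composition (n - i), F ((i + 1) :: c.blocks) := by
  rw [Finset.sum_sigma']
  symm
  refine Finset.sum_bij
    (i := fun (p : Σ i, Composition (n - i)) hp =>
      (⟨(p.1 + 1) :: p.2.blocks, by
          intro i hi
          rcases List.mem_cons.1 hi with rfl | hi
          · omega
          · exact p.2.blocks_pos hi, by
          have : p.1 < n + 1 := by simpa using hp
          rw [List.sum_cons, p.2.blocks_sum]; omega⟩ : Composition (n + 1)))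
    (fun _ _ => Finset.mem_univ _) ?_ ?_ (fun _ _ => rfl)
  · rintro ⟨i, c⟩ _ ⟨j, d⟩ _ h
    have h' := congrArg Composition.blocks h
    simp only [List.cons.injEq, Nat.add_right_cancel_iff] at h'
    obtain ⟨rfl, h'⟩ := h'
    rw [Composition.ext h']
  · intro c _
    obtain ⟨_ | ⟨b, bs⟩, hpos, hsum⟩ := c
    · simp at hsum
    · have hb := hpos (List.mem_cons_self)
      rw [List.sum_cons] at hsum
      refine ⟨⟨b - 1, ⟨bs, fun hi => hpos (List.mem_cons_of_mem _ hi), by omega⟩⟩, ?_, ?_⟩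
      · simp; omega
      · ext1
        simp only [List.cons.injEq, and_true]
        omega

theorem pull_eq_sum (f : List V → V) (Φ : List V → X) {n : ℕ} (w : List V) (hn : w.length = n) :
    pull f Φ w = ∑ c : Composition n, Φ ((w.splitWrtComposition c).map f) := by
  induction n using Nat.strong_induction_on generalizing Φ w with
  | _ n ih =>
  cases w with
  | nil =>
    subst hn
    have e : ∀ c : Composition 0, Φ ((([] : List V).splitWrtComposition c).map f) = Φ [] := by
      intro c
      have : c.blocks = [] := c.blocks_eq_nil.2 rfl
      simp [List.splitWrtComposition, List.splitWrtCompositionAux, this]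
    change _ = ∑ c : Composition 0, _
    simp [e, composition_card, pull_nil]
  | cons x w =>
    obtain ⟨n, rfl⟩ : ∃ m, n = m + 1 := ⟨n - 1, by simp at hn; omega⟩
    simp only [List.length_cons, Nat.add_right_cancel_iff] at hn
    unfold List.splitWrtComposition
    rw [sum_composition (fun bs => Φ (((x :: w).splitWrtCompositionAux bs).map f)), pull_cons,
      splitSum_eq_sum, hn]
    refine Finset.sum_congr rfl fun i _ => ?_
    rw [ih (n - i) (by omega) _ (w.drop i) (by simp [hn])]
    simp [List.splitWrtComposition, List.splitWrtCompositionAux_cons]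

end Words

/-! ### The signed sums of the definitions in terms of `ins` and `pull` -/

section Bridge

variable {k : Type*} [Field k] {N : ℕ} {V : Type*} [AddCommGroup V] [Module k V]
variable (𝒜 : ZMod N → Submodule k V) [DirectSum.Decomposition 𝒜]
variable {X : Type*} [AddCommGroup X] [Module k X]

theorem smul_splice_eq_shift (hN : Even N) (f : ∀ n : ℕ, MultilinearMap k (fun _ : Fin n => V) X)
    {m : ∀ n : ℕ, MultilinearMap k (fun _ : Fin n => V) V} {r s t n p : ℕ}
    (hm : IsHomogeneous 𝒜 𝒜 (m s) (2 - (s : ℤ))) (hn : n = r + s + t) (hp : p = r + t + 1)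
    (a : ℕ → V) :
    ((-1 : k) ^ (r * s + t)) • f p (fun i => splice 𝒜 (2 - (s : ℤ)) r (m s) a i) =
      ((-1 : k) ^ n.choose 2) • shift 𝒜 f (((shiftSeq 𝒜 n a).take r).map (tau 𝒜) ++
        shift 𝒜 m (((shiftSeq 𝒜 n a).drop r).take s) :: (shiftSeq 𝒜 n a).drop (r + s)) := by
  set w := shiftSeq 𝒜 n a with hw
  have hwl : w.length = n := length_shiftSeq 𝒜 n a
  have hwg : ∀ i, i < n → w.getD i 0 = koszul 𝒜 ((n : ℤ) - 1 - i) (a i) :=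
    fun i hi => getD_shiftSeq 𝒜 a hi
  have hv : (((w.drop r).take s)).length = s := by simp [hwl]; omega
  have hu : ((w.take r).map (tau 𝒜)).length = r := by simp [hwl]; omega
  -- Letters before the insertion carry the -1 contained in `tau`. The inserted entry carries the
  -- sign of `shift 𝒜 m` and the one for moving the parity operator of exponent `t` past `m s`.
  let σ : ℕ → k := fun i => if i < r then -1 else if i = r then
    (-1) ^ s.choose 2 * (-1) ^ (((t : ℤ) * (2 - (s : ℤ))).natAbs) else 1
  rw [shift_of_length 𝒜 f (n := p) (by simp [hwl]; omega)]
  have key : (fun i : Fin p => koszul 𝒜 ((p : ℤ) - 1 - i)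
      (((w.take r).map (tau 𝒜) ++ shift 𝒜 m ((w.drop r).take s) :: w.drop (r + s)).getD i 0)) =
      fun i : Fin p => σ i • splice 𝒜 (2 - (s : ℤ)) r (m s) a i := by
    funext ⟨i, hi⟩
    simp only [σ, splice]
    rcases lt_trichotomy i r with h | h | h
    · rw [if_pos h, if_pos h, List.getD_append _ _ _ _ (by omega), neg_one_smul]
      have : ((w.take r).map (tau 𝒜)).getD i 0 = tau 𝒜 (w.getD i 0) := by
        rw [List.getD_eq_getElem _ _ (by omega), List.getElem_map, List.getElem_take,
          List.getD_eq_getElem]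
      rw [this, hwg i (by omega), tau_apply, map_neg, koszul_koszul, koszul_koszul]
      congr 2
      refine koszul_congr 𝒜 ?_
      rw [← Int.even_sub]
      exact ⟨n - 1 - i, by subst hn hp; push_cast; ring⟩
    · subst h
      simp only [lt_irrefl, if_false, if_true]
      rw [List.getD_append_right _ _ _ _ (by omega), hu, Nat.sub_self, List.getD_cons_zero,
        shift_of_length 𝒜 m hv, map_smul, mul_smul]
      congr 1
      rw [show (p : ℤ) - 1 - i = t by subst hp; push_cast; ring, hm.koszul_apply hN]
      congr 2
      funext ⟨j, hj⟩
      have : ((w.drop i).take s).getD j 0 = w.getD (i + j) 0 := by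
        rw [List.getD_eq_getElem?_getD, List.getElem?_take, if_pos hj, List.getElem?_drop,
          List.getD_eq_getElem?_getD]
      dsimp only
      rw [this, hwg (i + j) (by omega), koszul_koszul, koszul_koszul]
      refine koszul_of_even 𝒜 ⟨n - 1 - i - j, ?_⟩ _
      subst hn; push_cast; ring
    · rw [if_neg h.not_gt, if_neg h.ne', if_neg h.not_gt, if_neg h.ne', one_smul,
        List.getD_append_right _ _ _ _ (by omega), hu]
      obtain ⟨j, rfl⟩ := Nat.exists_eq_add_of_lt h
      rw [show r + j + 1 - r = j + 1 by omega, List.getD_cons_succ]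
      have : (w.drop (r + s)).getD j 0 = w.getD (r + s + j) 0 := by
        rw [List.getD_eq_getElem?_getD, List.getElem?_drop, List.getD_eq_getElem?_getD]
      rw [this, hwg _ (by omega), koszul_koszul, show r + j + 1 + s - 1 = r + s + j by omega]
      refine koszul_of_even 𝒜 ⟨t - j - 1, ?_⟩ _
      subst hn hp; push_cast; ring
  rw [key, MultilinearMap.map_smul_univ, smul_smul, smul_smul]
  congr 1
  have hσ : ∏ i : Fin p, σ i =
      (-1) ^ r * ((-1) ^ s.choose 2 * (-1) ^ (((t : ℤ) * (2 - (s : ℤ))).natAbs)) := by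
    rw [Fin.prod_univ_eq_prod_range σ p, hp, add_right_comm, Finset.prod_range_add,
      Finset.prod_range_succ, Finset.prod_congr rfl (g := fun _ => (-1 : k))
        (fun i hi => if_pos (Finset.mem_range.1 hi)),
      Finset.prod_congr (s₂ := Finset.range t) rfl (g := fun _ => (1 : k)) (fun i _ => by
        simp only [σ]; rw [if_neg (by omega), if_neg (by omega)])]
    simp [σ]
  have ht : (-1 : k) ^ ((t : ℤ) * (2 - (s : ℤ))).natAbs = (-1) ^ (t * s) :=
    neg_one_pow_congr (by simp [Int.even_sub, parity_simps])
  -- The collected exponent differs from `r * s + t` by an even number.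
  have e : n.choose 2 + p.choose 2 + (r + (s.choose 2 + t * s)) =
      (r * s + t) + 2 * (r.choose 2 + s.choose 2 + t.choose 2 + r * t + s * t + r) := by
    subst hn hp
    simp only [choose_two_add, choose_two_succ]
    ring
  rw [hσ, ht, ← pow_add, ← pow_add, ← pow_add, ← pow_add, e, pow_add _ _ (2 * _), pow_mul]
  simp

theorem insertSum_eq_ins (hN : Even N) (f : ∀ n : ℕ, MultilinearMap k (fun _ : Fin n => V) X)
    {m : ∀ n : ℕ, MultilinearMap k (fun _ : Fin n => V) V}
    (hm : ∀ n : ℕ, IsHomogeneous 𝒜 𝒜 (m n) (2 - (n : ℤ))) (n : ℕ) (a : ℕ → V) :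
    insertSum 𝒜 f m n a =
      ((-1 : k) ^ n.choose 2) • ins (tau 𝒜) (shift 𝒜 m) (shift 𝒜 f) (shiftSeq 𝒜 n a) := by
  rw [ins_eq_sum, length_shiftSeq, Finset.smul_sum, insertSum]
  simp only [Finset.smul_sum]
  -- Here the position `r` becomes the outer index; `ins_eq_sum` counts lengths from zero, hence `s
  -- = i + 1`.
  rw [Finset.sum_comm' (t' := Finset.range n)
    (s' := fun r => (Finset.range (n - r)).map (addRightEmbedding 1))]
  · simp only [Finset.sum_map, addRightEmbedding_apply]
    refine Finset.sum_congr rfl fun r hr => Finset.sum_congr rfl fun i hi => ?_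
    simp only [Finset.mem_range] at hr hi
    exact smul_splice_eq_shift 𝒜 hN f (hm (i + 1)) (t := n - r - (i + 1)) (by omega)
      (by simp only [addRightEmbedding_apply]; omega) a
  · intro s r
    simp only [Finset.mem_Icc, Finset.mem_map, Finset.mem_range,
      addRightEmbedding_apply]
    constructor
    · rintro ⟨h₁, h₂⟩
      exact ⟨⟨s - 1, by omega, by omega⟩, by omega⟩
    · rintro ⟨⟨i, hi, rfl⟩, h⟩
      omega

theorem compSum_eq_pull (hN : Even N) (g : ∀ n : ℕ, MultilinearMap k (fun _ : Fin n => V) X)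
    {f : ∀ n : ℕ, MultilinearMap k (fun _ : Fin n => V) V}
    (hf : ∀ n : ℕ, IsHomogeneous 𝒜 𝒜 (f n) (1 - (n : ℤ))) (n : ℕ) (a : ℕ → V) :
    compSum 𝒜 g f n a =
      ((-1 : k) ^ n.choose 2) • pull (shift 𝒜 f) (shift 𝒜 g) (shiftSeq 𝒜 n a) := by
  set w := shiftSeq 𝒜 n a with hw
  have hwl : w.length = n := length_shiftSeq 𝒜 n a
  have hwg : ∀ i, i < n → w.getD i 0 = koszul 𝒜 ((n : ℤ) - 1 - i) (a i) :=
    fun i hi => getD_shiftSeq 𝒜 a hi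
  rw [pull_eq_sum _ _ w hwl, Finset.smul_sum, compSum]
  refine Finset.sum_congr rfl fun c _ => ?_
  -- Block sizes minus one, extended to all of `ℕ` so that sums over `Fin l` become sums over
  -- ranges; `-(u j)` is the degree of the `j`-th inner map.
  let u : ℕ → ℕ := fun j => c.blocks.getD j 0 - 1
  set l := c.length with hl
  have hu : ∀ j : Fin l, c.blocksFun j = u j + 1 := fun j => by
    have h := c.one_le_blocksFun j
    have : c.blocks.getD j 0 = c.blocksFun j := by
      rw [List.getD_eq_getElem _ _ (by rw [c.blocks_length]; exact j.2)]
      rfl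
    simp only [u, this]; omega
  have hs : ∀ j ≤ l, c.sizeUpTo j = ∑ i ∈ Finset.range j, (u i + 1) := by
    intro j hj
    induction j with
    | zero => simp
    | succ j ih =>
      rw [Finset.sum_range_succ, ← ih (by omega), c.sizeUpTo_succ (by omega)]
      congr 1
      exact hu ⟨j, by omega⟩
  have hsn : n = ∑ i ∈ Finset.range l, (u i + 1) := by rw [← hs l le_rfl, c.sizeUpTo_length]
  have hle : ∀ j : Fin l, c.sizeUpTo j + (u j + 1) ≤ n := fun j => by
    rw [← hu, ← c.sizeUpTo_succ']; exact c.sizeUpTo_le _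
  -- The total degree of the later factors is the number of later blocks minus the number of letters
  -- in them.
  have hIoi : ∀ j : Fin l, ∑ j' ∈ Finset.Ioi j, (1 - (c.blocksFun j' : ℤ)) =
      ((l : ℤ) - 1 - j) - (n - c.sizeUpTo j - (u j + 1)) := by
    intro j
    have e₁ : ∑ j' ∈ Finset.Ioi j, (1 - (c.blocksFun j' : ℤ)) =
        ∑ i ∈ Finset.Ico ((j : ℕ) + 1) l, (1 - ((u i + 1 : ℕ) : ℤ)) := by
      rw [show Finset.Ico ((j : ℕ) + 1) l = (Finset.Ioi j).map Fin.valEmbedding by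
        rw [Fin.map_valEmbedding_Ioi]; ext; simp, Finset.sum_map]
      exact Finset.sum_congr rfl fun i _ => by rw [hu]; rfl
    have e₂ : (n : ℤ) = c.sizeUpTo j + (u j + 1) +
        ∑ i ∈ Finset.Ico ((j : ℕ) + 1) l, ((u i + 1 : ℕ) : ℤ) := by
      conv_lhs => rw [hsn, ← Finset.sum_range_add_sum_Ico _ j.2, Finset.sum_range_succ,
        ← hs j j.2.le]
      push_cast; rfl
    rw [e₁, Finset.sum_sub_distrib, e₂]
    simp only [Finset.sum_const, Nat.card_Ico, nsmul_eq_mul, mul_one]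
    rw [Nat.cast_sub j.2]
    push_cast; ring
  rw [shift_of_length 𝒜 g (n := l) (by simp [hl])]
  have key : (fun j : Fin l => koszul 𝒜 ((l : ℤ) - 1 - j)
      (((w.splitWrtComposition c).map (shift 𝒜 f)).getD j 0)) =
      fun j : Fin l => ((-1 : k) ^ ((u j + 1).choose 2 + (l - 1 - j) * u j)) •
        f (c.blocksFun j) (fun i =>
          koszul 𝒜 (∑ j' ∈ Finset.Ioi j, (1 - (c.blocksFun j' : ℤ))) (a (c.sizeUpTo j + i))) := by
    funext j
    have hj : (j : ℕ) < (w.splitWrtComposition c).length := by simp [← hl]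
    have e : ((w.splitWrtComposition c).map (shift 𝒜 f)).getD j 0 =
        shift 𝒜 f ((w.take (c.sizeUpTo (j + 1))).drop (c.sizeUpTo j)) := by
      rw [List.getD_eq_getElem _ _ (by simpa using hj), List.getElem_map,
        List.getElem_splitWrtComposition']
    have hsz : c.sizeUpTo (j + 1) = c.sizeUpTo j + (u j + 1) := by
      rw [← hu]; exact c.sizeUpTo_succ' j
    rw [e, shift_of_length 𝒜 f (n := c.blocksFun j)
      (by have := hle j; simp [hwl, hsz, hu]; omega), map_smul, (hf _).koszul_apply hN, smul_smul,
      ← pow_add]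
    have e₂ : (fun i : Fin (c.blocksFun j) => koszul 𝒜 ((l : ℤ) - 1 - j)
        (koszul 𝒜 ((c.blocksFun j : ℤ) - 1 - i)
          (((w.take (c.sizeUpTo (j + 1))).drop (c.sizeUpTo j)).getD i 0))) =
          fun i : Fin (c.blocksFun j) =>
          koszul 𝒜 (∑ j' ∈ Finset.Ioi j, (1 - (c.blocksFun j' : ℤ))) (a (c.sizeUpTo j + i)) := by
      funext i
      have hi : (i : ℕ) < u j + 1 := hu j ▸ i.2
      have hle' := hle j
      have e₃ : ((w.take (c.sizeUpTo (j + 1))).drop (c.sizeUpTo j)).getD i 0 =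
          w.getD (c.sizeUpTo j + i) 0 := by
        rw [List.getD_eq_getElem?_getD, List.getElem?_drop, List.getElem?_take,
          if_pos (by omega), List.getD_eq_getElem?_getD]
      rw [e₃, hwg _ (by omega), koszul_koszul, koszul_koszul, hIoi]
      congr 1
      refine koszul_congr 𝒜 ?_
      have hb : (c.blocksFun j : ℤ) = u j + 1 := by rw [hu]; push_cast; rfl
      rw [← Int.even_sub, hb]
      exact ⟨(n : ℤ) - 1 - c.sizeUpTo j - i, by push_cast; ring⟩
    rw [e₂]
    congr 1
    refine neg_one_pow_congr ?_
    rw [hu]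
    have hj' := j.2
    simp only [Nat.even_add, Int.natAbs_even, Nat.even_mul, Int.even_mul]
    rw [show (l : ℤ) - 1 - j = ((l - 1 - j : ℕ) : ℤ) by omega,
      show (1 : ℤ) - ((u j + 1 : ℕ) : ℤ) = -(u j : ℤ) by push_cast; ring]
    simp only [even_neg, Int.even_coe_nat]
  rw [key, MultilinearMap.map_smul_univ, smul_smul, smul_smul]
  congr 1
  rw [Fin.prod_univ_eq_prod_range (fun j => (-1 : k) ^ ((u j + 1).choose 2 + (l - 1 - j) * u j)) l,
    Finset.prod_pow_eq_pow_sum, ← pow_add, ← pow_add]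
  have hh : ∑ j : Fin l, (c.blocksFun j - 1) * c.sizeUpTo j =
      ∑ j ∈ Finset.range l, u j * ∑ i ∈ Finset.range j, (u i + 1) := by
    rw [← Fin.sum_univ_eq_sum_range (fun j => u j * ∑ i ∈ Finset.range j, (u i + 1))]
    exact Finset.sum_congr rfl fun j _ => by rw [hu, hs j j.2.le]; rfl
  rw [hh]
  refine neg_one_pow_congr ?_
  have := choose_two_sum u l
  rw [← hsn] at this
  rw [this]
  simp only [Nat.even_add]
  tauto

end Bridge

/-! ### Algebras and morphisms as word functions; inversion and transport of structure -/

section Structures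

variable {k : Type*} [Field k] {N : ℕ} {V : Type*} [AddCommGroup V] [Module k V]
variable {𝒜 : ZMod N → Submodule k V} [DirectSum.Decomposition 𝒜]

theorem ins_idWord {τ : V →ₗ[k] V} {b : List V → V} (hb : b [] = 0) (w : List V) :
    ins τ b idWord w = b w := by
  cases w with
  | nil => exact hb.symm
  | cons x w =>
    rw [ins, ins_of_nil _ fun y w => idWord_cons_cons _ y w, zero_add,
      splitSum_eq_last fun a y c => idWord_cons_cons _ y c]
    rfl

/-- Every word is a `shiftSeq`, so identities on sequences are identities on words. The empty word
is separate because the relations are imposed only for `1 ≤ n`. -/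
theorem forall_word_of_forall_seq {X : Type*} [AddCommGroup X] [Module k X] {P Q : List V → X}
    (h0 : P [] = Q [])
    (h : ∀ n : ℕ, 1 ≤ n → ∀ a : ℕ → V, ((-1 : k) ^ n.choose 2) • P (shiftSeq 𝒜 n a) =
      ((-1 : k) ^ n.choose 2) • Q (shiftSeq 𝒜 n a)) (w : List V) : P w = Q w := by
  rcases w.length.eq_zero_or_pos with hw | hw
  · rw [List.length_eq_zero_iff.1 hw, h0]
  · obtain ⟨a, ha⟩ := exists_shiftSeq 𝒜 w
    rw [ha]
    exact smul_right_injective X (pow_ne_zero _ (neg_ne_zero.2 one_ne_zero)) (h _ hw a)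

namespace Algebra

variable (A : Algebra 𝒜)

/-- The operations of `A`, as a function of words in the shifted space. -/
noncomputable def word : List V → V := shift 𝒜 A.m

theorem isHomogeneous (n : ℕ) : IsHomogeneous 𝒜 𝒜 (A.m n) (2 - (n : ℤ)) := by
  rcases n.eq_zero_or_pos with rfl | hn
  · rw [A.m_zero]; exact isHomogeneous_zero _ _
  · exact A.homogeneous n hn

theorem isML_word : IsML k A.word := isML_shift 𝒜 _

theorem word_nil : A.word [] = 0 := shift_nil 𝒜 A.m_zero

theorem isHg_word : IsHg 𝒜 A.word 2 := by
  simpa [word] using isHg_shift (c := 2) A.isHomogeneous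

theorem word_map_tau (hN : Even N) (w : List V) :
    A.word (w.map (tau 𝒜)) = -tau 𝒜 (A.word w) := by
  simpa [word] using shift_map_tau hN A.isHomogeneous w

theorem ins_word (hN : Even N) (w : List V) : ins (tau 𝒜) A.word A.word w = 0 := by
  refine forall_word_of_forall_seq (𝒜 := 𝒜) (Q := fun _ => 0) rfl (fun n hn a => ?_) w
  rw [word, ← insertSum_eq_ins 𝒜 hN A.m A.isHomogeneous, A.relation n hn, smul_zero]

/-- The A-infinity structure with given shifted operations. -/
noncomputable def ofWord (hN : Even N) (b : List V → V) (h : IsML k b) (hg : IsHg 𝒜 b 2)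
    (h0 : b [] = 0) (hb : ∀ w, ins (tau 𝒜) b b w = 0) : Algebra 𝒜 where
  m := unshift 𝒜 b h
  m_zero := eq_zero_of_shift 𝒜 fun w hw => by
    rw [shift_unshift, List.length_eq_zero_iff.1 hw, h0]
  homogeneous n _ := isHomogeneous_unshift h (c := 2) (by simpa using hg) n
  relation n _ a := by
    rw [insertSum_eq_ins 𝒜 hN _ (isHomogeneous_unshift h (c := 2) (by simpa using hg)),
      shift_unshift, hb, smul_zero]

theorem word_ofWord (hN : Even N) (b : List V → V) (h : IsML k b) (hg : IsHg 𝒜 b 2)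
    (h0 : b [] = 0) (hb : ∀ w, ins (tau 𝒜) b b w = 0) : (ofWord hN b h hg h0 hb).word = b :=
  shift_unshift 𝒜 b h

end Algebra

namespace Hom

variable {A B C : Algebra 𝒜} (F : Hom A B)

/-- The components of `F`, as a function of words in the shifted space. -/
noncomputable def word : List V → V := shift 𝒜 F.f

theorem isHomogeneous (n : ℕ) : IsHomogeneous 𝒜 𝒜 (F.f n) (1 - (n : ℤ)) := by
  rcases n.eq_zero_or_pos with rfl | hn
  · rw [F.f_zero]; exact isHomogeneous_zero _ _
  · exact F.homogeneous n hn

theorem isML_word : IsML k F.word := isML_shift 𝒜 _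

theorem word_nil : F.word [] = 0 := shift_nil 𝒜 F.f_zero

theorem isHg_word : IsHg 𝒜 F.word 1 := by
  simpa [word] using isHg_shift (c := 1) F.isHomogeneous

theorem word_map_tau (hN : Even N) (w : List V) :
    F.word (w.map (tau 𝒜)) = tau 𝒜 (F.word w) := by
  simpa [word] using shift_map_tau hN F.isHomogeneous w

theorem word_relation (hN : Even N) (w : List V) :
    pull F.word B.word w = ins (tau 𝒜) A.word F.word w := by
  refine forall_word_of_forall_seq (𝒜 := 𝒜) B.word_nil (fun n hn a => ?_) w
  rw [word, Algebra.word, Algebra.word, ← insertSum_eq_ins 𝒜 hN F.f A.isHomogeneous,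
    ← compSum_eq_pull 𝒜 hN B.m F.isHomogeneous, F.relation n hn]

/-- The morphism with given shifted components. -/
noncomputable def ofWord (hN : Even N) (A B : Algebra 𝒜) (f : List V → V) (h : IsML k f)
    (hg : IsHg 𝒜 f 1) (h0 : f [] = 0) (hf : ∀ w, pull f B.word w = ins (tau 𝒜) A.word f w) :
    Hom A B where
  f := unshift 𝒜 f h
  f_zero := eq_zero_of_shift 𝒜 fun w hw => by
    rw [shift_unshift, List.length_eq_zero_iff.1 hw, h0]
  homogeneous n _ := isHomogeneous_unshift h (c := 1) (by simpa using hg) n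
  relation n _ a := by
    rw [insertSum_eq_ins 𝒜 hN _ A.isHomogeneous,
      compSum_eq_pull 𝒜 hN _ (isHomogeneous_unshift h (c := 1) (by simpa using hg)),
      shift_unshift]
    exact congrArg _ (hf _)

theorem word_ofWord (hN : Even N) (A B : Algebra 𝒜) (f : List V → V) (h : IsML k f)
    (hg : IsHg 𝒜 f 1) (h0 : f [] = 0) (hf : ∀ w, pull f B.word w = ins (tau 𝒜) A.word f w) :
    (ofWord hN A B f h hg h0 hf).word = f :=
  shift_unshift 𝒜 f h

/-- The identity morphism. -/
noncomputable def id (hN : Even N) (A : Algebra 𝒜) : Hom A A :=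
  ofWord hN A A idWord IsML.idWord IsHg.idWord idWord_nil fun w => by
    rw [pull_idWord_left (k := k) A.isML_word, ins_idWord A.word_nil]

theorem id_f (hN : Even N) (A : Algebra 𝒜) : (id hN A).f = idMaps k V :=
  funext fun _ => multilinear_eq_of_shift_eq 𝒜 fun w _ =>
    congrFun ((word_ofWord hN A A idWord _ _ _ _).trans (shift_idMaps 𝒜).symm) w

/-- The composite of two morphisms. -/
noncomputable def comp (hN : Even N) (G : Hom B C) (F : Hom A B) : Hom A C :=
  ofWord hN A C (pull F.word G.word) (F.isML_word.pull G.isML_word) (F.isHg_word.pull G.isHg_word)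
    G.word_nil fun w => by
      rw [← pull_pull F.word G.word_nil C.isML_word, funext (G.word_relation hN),
        ins_pull B.word_nil F.word_nil (F.word_map_tau hN) (F.word_relation hN) G.isML_word]

theorem isComp_comp (hN : Even N) (G : Hom B C) (F : Hom A B) : G.IsComp F (comp hN G F) := by
  intro n _ a
  rw [apply_eq_shift 𝒜, compSum_eq_pull 𝒜 hN _ F.isHomogeneous]
  exact congrArg (_ • ·) (congrFun (word_ofWord hN A C (pull F.word G.word) _ _ _ _) _)

theorem word_singleton (h : F.f 1 = idMaps k V 1) (x : V) : F.word [x] = x := by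
  rw [word, shift_congr 𝒜 (g := idMaps k V) h, shift_idMaps, idWord_singleton]

theorem compSum_eq_idMaps (hN : Even N) {f g : ∀ n : ℕ, MultilinearMap k (fun _ : Fin n => V) V}
    (hf : ∀ n : ℕ, IsHomogeneous 𝒜 𝒜 (f n) (1 - (n : ℤ)))
    (h : ∀ w, pull (shift 𝒜 f) (shift 𝒜 g) w = idWord w) (n : ℕ) (a : ℕ → V) :
    compSum 𝒜 g f n a = idMaps k V n (fun i => a i) := by
  rw [compSum_eq_pull 𝒜 hN _ hf, h, apply_eq_shift 𝒜, shift_idMaps]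

theorem pull_invWord_pull {f : List V → V} (h0 : f [] = 0) (h1 : ∀ x, f [x] = x) (hf : IsML k f)
    {Φ : List V → V} (hΦ : IsML k Φ) (w : List V) : pull (invWord f) (pull f Φ) w = Φ w := by
  rw [pull_pull _ h0 hΦ, funext (pull_invWord_left h0 h1 hf), pull_idWord_left hΦ]

theorem pull_pull_invWord {f : List V → V} (h0 : f [] = 0) (h1 : ∀ x, f [x] = x)
    {Φ : List V → V} (hΦ : IsML k Φ) (w : List V) : pull f (pull (invWord f) Φ) w = Φ w := by
  rw [pull_pull _ (invWord_nil f) hΦ, funext (pull_invWord h0 h1), pull_idWord_left hΦ]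

/-- A morphism with linear part the identity is an isomorphism. -/
theorem isIso_of_f_one (hN : Even N) (h : F.f 1 = idMaps k V 1) : F.IsIso := by
  have h0 := F.word_nil
  have h1 := F.word_singleton h
  have hML := F.isML_word
  let G : Hom B A := ofWord hN B A (invWord F.word) hML.invWord F.isHg_word.invWord rfl fun w => by
    have hi : IsML k (ins (tau 𝒜) B.word (invWord F.word)) := B.isML_word.ins hML.invWord
    -- The right side is substituted by `F.word` and back. By `ins_pull` the inner substitution
    -- becomes an insertion of `A.word` into the identity, which is `A.word` itself.
    rw [← pull_invWord_pull h0 h1 hML hi,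
      ← funext (ins_pull B.word_nil h0 (F.word_map_tau hN) (F.word_relation hN) hML.invWord),
      funext (pull_invWord h0 h1), funext (ins_idWord A.word_nil)]
  have hG : shift 𝒜 G.f = invWord F.word := word_ofWord hN B A (invWord F.word) _ _ _ _
  refine ⟨G, fun n _ a => compSum_eq_idMaps hN F.isHomogeneous (fun w => ?_) n a,
    fun n _ a => compSum_eq_idMaps hN G.isHomogeneous (fun w => ?_) n a⟩
  · rw [hG]; exact pull_invWord h0 h1 w
  · rw [hG]; exact pull_invWord_left h0 h1 hML w

/-- Transport of structure: any family of maps with linear part the identity is an isomorphism onto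
some A-infinity structure. -/
theorem exists_transport (hN : Even N) (A : Algebra 𝒜)
    (f : ∀ n : ℕ, MultilinearMap k (fun _ : Fin n => V) V)
    (hf : ∀ n : ℕ, IsHomogeneous 𝒜 𝒜 (f n) (1 - (n : ℤ))) (h0 : f 0 = 0)
    (h1 : f 1 = idMaps k V 1) : ∃ (B : Algebra 𝒜) (F : Hom A B), F.f = f := by
  set φ := shift 𝒜 f with hφ
  have hML : IsML k φ := isML_shift 𝒜 f
  have hg : IsHg 𝒜 φ 1 := by simpa using isHg_shift (c := 1) hf
  have hτ : ∀ w, φ (w.map (tau 𝒜)) = tau 𝒜 (φ w) := fun w => by simpa using shift_map_tau hN hf w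
  have h0' : φ [] = 0 := shift_nil 𝒜 h0
  have h1' : ∀ x, φ [x] = x := fun x => by
    rw [hφ, shift_congr 𝒜 (g := idMaps k V) h1, shift_idMaps, idWord_singleton]
  have hi : IsML k (ins (tau 𝒜) A.word φ) := A.isML_word.ins hML
  -- Conjugation by `φ`: the morphism relation is solved for the target operations.
  set b := pull (invWord φ) (ins (tau 𝒜) A.word φ) with hb
  have hbML : IsML k b := hML.invWord.pull hi
  have hφb : ∀ w, pull φ b w = ins (tau 𝒜) A.word φ w := pull_pull_invWord h0' h1' hi
  have hb0 : b [] = 0 := rfl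
  -- Intertwining carries the square of the new coderivation to that of the old one, which vanishes
  -- by `ins_ins`.
  have hbb : ∀ w, ins (tau 𝒜) b b w = 0 := fun w => by
    rw [← pull_invWord_pull h0' h1' hML (hbML.ins hbML),
      ← funext (ins_pull hb0 h0' hτ hφb hbML), funext hφb,
      funext (ins_ins A.word_nil (A.word_map_tau hN) (A.ins_word hN) hML), pull_zero]
  have hbg : IsHg 𝒜 b 2 := by
    have := hg.invWord.pull (A.isHg_word.ins hg)
    rwa [one_add_one_eq_two] at this
  refine ⟨Algebra.ofWord hN b hbML hbg hb0 hbb,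
    { f := f
      f_zero := h0
      homogeneous := fun n _ => hf n
      relation := fun n _ a => ?_ }, rfl⟩
  rw [insertSum_eq_ins 𝒜 hN _ A.isHomogeneous, compSum_eq_pull 𝒜 hN _ hf]
  have e : shift 𝒜 (Algebra.ofWord hN b hbML hbg hb0 hbb).m = b :=
    Algebra.word_ofWord hN b hbML hbg hb0 hbb
  rw [e]
  exact congrArg _ (hφb _)

end Hom

end Structures

/-! ### Families concentrated in arities 1 and p, and the lowest-order terms of the relations -/

section FirstOrder

variable {k : Type*} [Field k] {V : Type*} [AddCommGroup V] [Module k V]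
variable {X : Type*} [AddCommGroup X] [Module k X]

/-- `f` is the identity on letters and vanishes on all words of length other than `1` and `p`. -/
structure IsElementary (f : List V → V) (p : ℕ) : Prop where
  singleton : ∀ x, f [x] = x
  eq_zero : ∀ u, u.length ≠ 1 → u.length ≠ p → f u = 0

variable {f : List V → V} {p : ℕ} {Φ : List V → X}

theorem IsElementary.pull_of_lt (hf : IsElementary f p) (hΦ : IsML k Φ) {w : List V}
    (hw : w.length < p) : pull f Φ w = Φ w := by
  induction w generalizing Φ with
  | nil => rfl
  | cons x w ih =>
    rw [List.length_cons] at hw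
    rw [pull_cons, splitSum_eq_sum, Finset.sum_eq_single_of_mem 0 (by simp)]
    · simpa [hf.singleton] using ih (hΦ.tail x) (by omega)
    · intro i hi hi0
      rw [Finset.mem_range] at hi
      rw [hf.eq_zero (x :: w.take i) (by rw [List.length_cons, List.length_take]; omega)
      (by rw [List.length_cons, List.length_take]; omega)]
      simp only [hΦ.zero_cons, pull_zero]

theorem IsElementary.pull_of_le (hf : IsElementary f p) (hp : 2 ≤ p) (hΦ : IsML k Φ) (x : V)
    {w : List V} (h₁ : p ≤ w.length + 1) :
    pull f Φ (x :: w) = pull f (fun v => Φ (x :: v)) w +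
      pull f (fun v => Φ (f (x :: w.take (p - 1)) :: v)) (w.drop (p - 1)) := by
  rw [pull_cons, splitSum_eq_sum, ← Finset.sum_subset (s₁ := {0, p - 1}),
    Finset.sum_pair (by omega)]
  · simp [hf.singleton]
  · intro i hi
    simp only [Finset.mem_insert, Finset.mem_singleton] at hi
    rw [Finset.mem_range]; omega
  · intro i hi hi'
    simp only [Finset.mem_insert, Finset.mem_singleton, not_or] at hi'
    rw [Finset.mem_range] at hi
    rw [hf.eq_zero (x :: w.take i) (by rw [List.length_cons, List.length_take]; omega)
      (by rw [List.length_cons, List.length_take]; omega)]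
    simp only [hΦ.zero_cons, pull_zero]

theorem IsElementary.pull_of_eq (hf : IsElementary f p) (hp : 2 ≤ p) (hΦ : IsML k Φ)
    {w : List V} (hw : w.length = p) : pull f Φ w = Φ w + Φ [f w] := by
  cases w with
  | nil => simp at hw; omega
  | cons x w =>
    rw [List.length_cons] at hw
    rw [hf.pull_of_le hp hΦ x hw.ge, hf.pull_of_lt (hΦ.tail x) (by omega),
      List.drop_of_length_le (by omega), List.take_of_length_le (by omega), pull_nil]

/-- Two blocks of length `p` would need more than `p + 1` letters, so there is at most one, and it
leaves a single letter at one of the two ends. -/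
theorem IsElementary.pull_of_succ (hf : IsElementary f p) (hp : 2 ≤ p) (hΦ : IsML k Φ)
    {w : List V} (hw : w.length = p + 1) : pull f Φ w =
      Φ w + Φ [w.getD 0 0, f (w.drop 1)] + Φ [f (w.take p), w.getD p 0] := by
  cases w with
  | nil => simp at hw
  | cons x w =>
    obtain ⟨p, rfl⟩ : ∃ q, p = q + 1 := ⟨p - 1, by omega⟩
    rw [List.length_cons, Nat.add_right_cancel_iff] at hw
    have hd : w.drop p = [w.getD p 0] := by
      rw [List.drop_eq_getElem_cons (by omega), List.drop_of_length_le (by omega),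
        List.getD_eq_getElem _ _ (by omega)]
    rw [hf.pull_of_le hp hΦ x (by omega), hf.pull_of_eq hp (hΦ.tail x) hw, Nat.add_sub_cancel, hd]
    simp [pull, pullAux, hf.singleton]

variable {τ : V →ₗ[k] V} {b : List V → V}

theorem IsML.apply_zero {Φ : List V → X} (h : IsML k Φ) (u v : List V) : Φ (u ++ 0 :: v) = 0 :=
  (h u v).map_zero

theorem take_one_drop {w : List V} {r : ℕ} (h : r < w.length) :
    (w.drop r).take (0 + 1) = [w.getD r 0] := by
  rw [List.drop_eq_getElem_cons h, List.getD_eq_getElem _ _ h]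
  rfl

theorem sum_triangle_eq (T : ℕ → ℕ → X) (l : ℕ)
    (h : ∀ r i, r + i < l → i ≠ l - 1 → T r i = 0) (hl : 1 ≤ l) :
    ∑ r ∈ Finset.range l, ∑ i ∈ Finset.range (l - r), T r i = T 0 (l - 1) := by
  rw [Finset.sum_eq_single_of_mem 0 (by simp; omega),
    Finset.sum_eq_single_of_mem (l - 1) (by simp; omega)]
  · intro i hi hi'
    rw [Finset.mem_range] at hi
    exact h 0 i (by omega) hi'
  · intro r hr hr0
    rw [Finset.mem_range] at hr
    refine Finset.sum_eq_zero fun i hi => ?_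
    rw [Finset.mem_range] at hi
    exact h r i (by omega) (by omega)

theorem sum_triangle_comm (T : ℕ → ℕ → X) (l : ℕ) :
    ∑ r ∈ Finset.range l, ∑ i ∈ Finset.range (l - r), T r i =
      ∑ i ∈ Finset.range l, ∑ r ∈ Finset.range (l - i), T r i := by
  refine Finset.sum_comm' fun r i => ?_
  simp only [Finset.mem_range]
  omega

/-- The summands of `ins τ b Φ w` with `b` applied to a word of length two. -/
def insTwo (τ : V →ₗ[k] V) (b : List V → V) (Φ : List V → X) (n : ℕ) (w : List V) : X :=
  ∑ r ∈ Finset.range n,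
    Φ ((w.take r).map τ ++ b ((w.drop r).take 2) :: w.drop (r + 2))

/-- Inserting `b` on at least two letters leaves fewer than `p`, where `f` vanishes unless only one
is left; on one letter `b` is zero. -/
theorem IsElementary.ins_of_le (hf : IsElementary f p) (hML : IsML k f) (hb : ∀ x, b [x] = 0)
    (hb0 : b [] = 0) {w : List V} (hw : w.length ≤ p) : ins τ b f w = b w := by
  rcases w.length.eq_zero_or_pos with h0 | h0
  · rw [List.length_eq_zero_iff.1 h0, hb0]; rfl
  · rw [ins_eq_sum, sum_triangle_eq _ _ _ h0]
    · simp [Nat.sub_add_cancel h0, hf.singleton]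
    · intro r i hri hi
      rcases i.eq_zero_or_pos with rfl | hi0
      · rw [take_one_drop (by omega), hb, hML.apply_zero]
      · exact hf.eq_zero _ (by simp; omega) (by simp; omega)

/-- Only two insertions survive: `b` takes the whole word and leaves one letter, or takes two
letters and leaves `p`. -/
theorem IsElementary.ins_of_succ (hf : IsElementary f p) (hp : 2 ≤ p) (hML : IsML k f)
    (hb : ∀ x, b [x] = 0) {w : List V} (hw : w.length = p + 1) :
    ins τ b f w = b w + insTwo τ b f p w := by
  rw [ins_eq_sum, sum_triangle_comm, hw, ← Finset.sum_subset (s₁ := {p, 1}),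
    Finset.sum_pair (by omega)]
  · congr 1
    rw [Nat.add_sub_cancel_left, Finset.sum_range_one,
      List.drop_of_length_le (i := 0 + (p + 1)) (by omega),
      List.drop_zero, List.take_of_length_le hw.le]
    exact hf.singleton _
  · intro i hi
    simp only [Finset.mem_insert, Finset.mem_singleton] at hi
    rw [Finset.mem_range]; omega
  · intro i hi hi'
    simp only [Finset.mem_insert, Finset.mem_singleton, not_or] at hi'
    rw [Finset.mem_range] at hi
    refine Finset.sum_eq_zero fun r hr => ?_
    rw [Finset.mem_range] at hr
    rcases i.eq_zero_or_pos with rfl | hi0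
    · rw [take_one_drop (by omega), hb, hML.apply_zero]
    · exact hf.eq_zero _ (by simp; omega) (by simp; omega)

/-- In arity n + 1 only b_2 and b_n can meet. The product inside b_n gives `insTwo`, and b_n inside
the product gives the two boundary terms. The bound `3 ≤ n` keeps the two kinds of terms distinct.
-/
theorem ins_self_of_succ {n : ℕ} (hn : 3 ≤ n) (hML : IsML k b) (hb : ∀ x, b [x] = 0)
    (h : ∀ v, 3 ≤ v.length → v.length < n → b v = 0) {w : List V} (hw : w.length = n + 1) :
    ins τ b b w = insTwo τ b b n w +
      (b [τ (w.getD 0 0), b (w.drop 1)] + b [b (w.take n), w.getD n 0]) := by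
  have hz : ∀ r i, r + i < n + 1 → i ≠ 1 → i ≠ n - 1 →
      b ((w.take r).map τ ++ b ((w.drop r).take (i + 1)) :: w.drop (r + (i + 1))) = 0 := by
    intro r i hri hi₁ hi₂
    rcases i.eq_zero_or_pos with rfl | hi0
    · rw [take_one_drop (by omega), hb, hML.apply_zero]
    · rcases lt_or_ge i n with h' | h'
      · rw [h ((w.drop r).take (i + 1)) (by simp; omega) (by simp; omega), hML.apply_zero]
      · obtain rfl : r = 0 := by omega
        rw [List.drop_of_length_le (i := 0 + (i + 1)) (by omega)]
        exact hb _
  rw [ins_eq_sum, sum_triangle_comm, hw, ← Finset.sum_subset (s₁ := {1, n - 1}),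
    Finset.sum_pair (by omega)]
  · refine congrArg₂ (· + ·) (by simp [insTwo]) ?_
    rw [show n + 1 - (n - 1) = 2 by omega, Finset.sum_range_succ, Finset.sum_range_one,
      Nat.sub_add_cancel (by omega), add_comm]
    have hd : w.drop n = [w.getD n 0] := by
      rw [List.drop_eq_getElem_cons (by omega), List.drop_of_length_le (by omega),
        List.getD_eq_getElem _ _ (by omega)]
    have ht : w.take 1 = [w.getD 0 0] := by
      rw [List.take_one, List.head?_eq_getElem?, List.getElem?_eq_getElem (by omega),
        List.getD_eq_getElem _ _ (by omega)]
      rfl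
    rw [ht, List.take_of_length_le (l := w.drop 1) (by simp; omega),
      List.drop_of_length_le (i := 1 + n) (by omega), zero_add, hd]
    rfl
  · intro i hi
    simp only [Finset.mem_insert, Finset.mem_singleton] at hi
    rw [Finset.mem_range]; omega
  · intro i hi hi'
    simp only [Finset.mem_insert, Finset.mem_singleton, not_or] at hi'
    rw [Finset.mem_range] at hi
    refine Finset.sum_eq_zero fun r hr => ?_
    rw [Finset.mem_range] at hr
    exact hz r i (by omega) hi'.1 hi'.2

end FirstOrder

/-! ### The Hochschild differential on shifted maps -/

section Hochschild

variable {k : Type*} [Field k] {N : ℕ} {V : Type*} [AddCommGroup V] [Module k V]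
variable {𝒜 : ZMod N → Submodule k V} [DirectSum.Decomposition 𝒜]

theorem shift_pair (m : ∀ n : ℕ, MultilinearMap k (fun _ : Fin n => V) V) (x y : V) :
    shift 𝒜 m [x, y] = -m 2 ![koszul 𝒜 1 x, y] := by
  rw [shift_of_length 𝒜 m (n := 2) rfl]
  simp only [Nat.choose_self, pow_one, neg_one_smul]
  congr 2
  funext i
  fin_cases i <;> simp [koszul_of_even]

/-- The Hochschild differential in terms of shifted maps. -/
theorem hochschildDiff_eq (hN : Even N) {f m : ∀ n : ℕ, MultilinearMap k (fun _ : Fin n => V) V}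
    {n : ℕ} {q : ℤ} (hf : IsHomogeneous 𝒜 𝒜 (f n) q) (hm : IsHomogeneous 𝒜 𝒜 (m 2) 0)
    (a : ℕ → V) :
    hochschildDiff 𝒜 (m 2) n q (f n) a = ((-1 : k) ^ n.choose 2) •
      (insTwo (tau 𝒜) (shift 𝒜 m) (shift 𝒜 f) n (shiftSeq 𝒜 (n + 1) a) +
        (-shift 𝒜 m [koszul 𝒜 (q + 1 + n) ((shiftSeq 𝒜 (n + 1) a).getD 0 0),
            shift 𝒜 f ((shiftSeq 𝒜 (n + 1) a).drop 1)] +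
          ((-1 : k) ^ (n + q).natAbs) • shift 𝒜 m [shift 𝒜 f ((shiftSeq 𝒜 (n + 1) a).take n),
            (shiftSeq 𝒜 (n + 1) a).getD n 0])) := by
  set w := shiftSeq 𝒜 (n + 1) a with hw
  have hwl : w.length = n + 1 := length_shiftSeq 𝒜 (n + 1) a
  have hwg : ∀ i, i < n + 1 → w.getD i 0 = koszul 𝒜 ((n : ℤ) - i) (a i) := fun i hi => by
    rw [getD_shiftSeq 𝒜 a hi]; congr 2; push_cast; ring
  have hML := isML_shift 𝒜 m
  have e₁ : shift 𝒜 f (w.drop 1) = ((-1 : k) ^ n.choose 2) • f n (fun i => a (i + 1)) := by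
    rw [shift_of_length 𝒜 f (n := n) (by simp [hwl])]
    congr 2
    funext i
    have : (w.drop 1).getD i 0 = w.getD (1 + i) 0 := by
      rw [List.getD_eq_getElem?_getD, List.getElem?_drop, List.getD_eq_getElem?_getD]
    rw [this, hwg _ (by omega), koszul_koszul, add_comm 1 (i : ℕ)]
    exact koszul_of_even 𝒜 ⟨(n : ℤ) - 1 - i, by push_cast; ring⟩ _
  have e₂ : shift 𝒜 f (w.take n) =
      ((-1 : k) ^ n.choose 2 * (-1) ^ q.natAbs) • koszul 𝒜 1 (f n (fun i => a i)) := by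
    rw [shift_of_length 𝒜 f (n := n) (by simp [hwl]), hf.koszul_apply hN, one_mul, mul_smul,
      smul_smul ((-1 : k) ^ q.natAbs), neg_one_pow_mul_self, one_smul]
    congr 2
    funext i
    have : (w.take n).getD i 0 = w.getD i 0 := by
      rw [List.getD_eq_getElem?_getD, List.getElem?_take, if_pos i.2, List.getD_eq_getElem?_getD]
    rw [this, hwg _ (by omega), koszul_koszul]
    exact congrFun (congrArg _ (koszul_congr 𝒜 (by
      simp only [Int.even_add, Int.even_sub, Int.not_even_one]; tauto))) _
  have hs₁ : ∀ (c : k) x y, shift 𝒜 m [c • x, y] = c • shift 𝒜 m [x, y] :=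
    fun c x y => (hML [] [y]).map_smul c x
  have hs₂ : ∀ (c : k) x y, shift 𝒜 m [x, c • y] = c • shift 𝒜 m [x, y] :=
    fun c x y => (hML [x] []).map_smul c y
  have t₁ : m 2 ![koszul 𝒜 q (a 0), f n (fun i => a (i + 1))] = ((-1 : k) ^ n.choose 2) •
      -shift 𝒜 m [koszul 𝒜 (q + 1 + n) (w.getD 0 0), shift 𝒜 f (w.drop 1)] := by
    rw [e₁, hs₂, smul_neg, smul_smul, neg_one_pow_mul_self, one_smul, shift_pair, neg_neg,
      hwg 0 (by omega), koszul_koszul, koszul_koszul,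
      koszul_congr 𝒜 (p := 1 + (q + 1 + n) + (n - (0 : ℕ))) (q := q)]
    simp only [Int.even_add, Int.not_even_one, Nat.cast_zero, sub_zero]
    tauto
  -- The inner terms are insertions of the product, the case `s = 2` of `smul_splice_eq_shift`, up
  -- to a sign independent of `r`.
  have t₂ : ∑ r ∈ Finset.range n, ((-1 : k) ^ (r + 1)) • f n (fun i => splice 𝒜 0 r (m 2) a i) =
      ((-1 : k) ^ n.choose 2) • insTwo (tau 𝒜) (shift 𝒜 m) (shift 𝒜 f) n w := by
    rw [insTwo, Finset.smul_sum]
    refine Finset.sum_congr rfl fun r hr => ?_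
    rw [Finset.mem_range] at hr
    have := smul_splice_eq_shift 𝒜 hN f (m := m) (r := r) (s := 2) (t := n - 1 - r) (n := n + 1)
      (p := n) (by simpa using hm) (by omega) (by omega) a
    rw [show (2 - ((2 : ℕ) : ℤ)) = 0 by norm_num] at this
    have := congrArg (((-1 : k) ^ (n.choose 2 + (n + 1).choose 2)) • ·) this
    simp only [smul_smul, ← pow_add] at this
    rw [choose_two_succ] at this
    refine Eq.trans ?_ (this.trans ?_) <;> congr 1 <;> refine neg_one_pow_congr ?_ <;>
      simp only [Nat.even_iff] <;> omega
  have t₃ : ((-1 : k) ^ (n + 1)) • m 2 ![f n (fun i => a i), a n] = ((-1 : k) ^ n.choose 2) •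
      ((-1 : k) ^ (n + q).natAbs) • shift 𝒜 m [shift 𝒜 f (w.take n), w.getD n 0] := by
    rw [e₂, hs₁, shift_pair, hwg n (by omega), koszul_koszul, koszul_of_even 𝒜 ⟨1, rfl⟩,
      koszul_of_even 𝒜 (p := n - n) (by simp), smul_neg, smul_neg, smul_neg, smul_smul,
      smul_smul, ← neg_smul]
    congr 1
    rw [mul_mul_mul_comm, neg_one_pow_mul_self, one_mul, ← pow_add,
      neg_eq_neg_one_mul ((-1 : k) ^ _), ← pow_succ']
    refine neg_one_pow_congr ?_
    simp only [Nat.even_add, Int.natAbs_even, Int.even_add, Nat.not_even_one, Int.even_coe_nat]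
    tauto
  change m 2 ![koszul 𝒜 q (a 0), f n (fun i => a (i + 1))] +
    ∑ r ∈ Finset.range n, ((-1 : k) ^ (r + 1)) • f n (fun i => splice 𝒜 0 r (m 2) a i) +
      ((-1 : k) ^ (n + 1)) • m 2 ![f n (fun i => a i), a n] = _
  rw [t₁, t₂, t₃, ← smul_add, ← smul_add]
  congr 1
  abel

end Hochschild

/-! ### Removing higher products one by one, and passing to the limit -/

section Formality

variable {k : Type*} [Field k] {N : ℕ} {V : Type*} [AddCommGroup V] [Module k V]
variable {𝒜 : ZMod N → Submodule k V} [DirectSum.Decomposition 𝒜]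

theorem word_singleton_eq_zero {A : Algebra 𝒜} (hA : A.m 1 = 0) (x : V) : A.word [x] = 0 :=
  shift_eq_zero 𝒜 hA

/-- The first non-vanishing higher product is a Hochschild cocycle. -/
theorem hochschildDiff_m_eq_zero (hN : Even N) {A : Algebra 𝒜} (hA : A.m 1 = 0) {n : ℕ}
    (hn : 3 ≤ n) (h : ∀ l, 3 ≤ l → l < n → A.m l = 0) :
    hochschildDiff 𝒜 (A.m 2) n (2 - (n : ℤ)) (A.m n) = 0 := by
  funext a
  have hw : (shiftSeq 𝒜 (n + 1) a).length = n + 1 := length_shiftSeq 𝒜 _ _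
  have h2 : IsHomogeneous 𝒜 𝒜 (A.m 2) 0 := by simpa using A.isHomogeneous 2
  have key := ins_self_of_succ (τ := tau 𝒜) hn A.isML_word (word_singleton_eq_zero hA)
    (fun v h₁ h₂ => shift_eq_zero 𝒜 (h _ h₁ h₂)) hw
  rw [A.ins_word hN] at key
  rw [hochschildDiff_eq hN (A.isHomogeneous n) h2]
  -- For q = 2 - n the exponent q + 1 + n is odd, so the sign operator is `-tau`, and the Hochschild
  -- expression becomes the relation of arity n + 1.
  have e : ∀ x y, -shift 𝒜 A.m [koszul 𝒜 (2 - (n : ℤ) + 1 + n) x, y] = A.word [tau 𝒜 x, y] := by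
    intro x y
    rw [koszul_congr 𝒜 (p := 2 - (n : ℤ) + 1 + n) (q := 1) (by
      rw [← Int.even_sub]; exact ⟨1, by ring⟩), tau_apply,
      (A.isML_word.head [y]).map_neg]
    rfl
  rw [e, show ((n : ℤ) + (2 - n)).natAbs = 2 by simp, neg_one_sq, one_smul]
  exact (congrArg _ key.symm).trans (smul_zero _)

theorem exists_hochschildDiff_eq {μ : MultilinearMap k (fun _ : Fin 2 => V) V} {p : ℕ} {q : ℤ}
    (h : Subsingleton (HochschildCohomology 𝒜 μ (p + 1) q))
    {φ : MultilinearMap k (fun _ : Fin (p + 1) => V) V} (hφ : IsHomogeneous 𝒜 𝒜 φ q)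
    (hd : hochschildDiff 𝒜 μ (p + 1) q φ = 0) :
    ∃ ψ : MultilinearMap k (fun _ : Fin p => V) V, IsHomogeneous 𝒜 𝒜 ψ q ∧
      ∀ a : ℕ → V, hochschildDiff 𝒜 μ p q ψ a = φ (fun i => a i) := by
  have hmem : (⟨φ, hφ, hd⟩ : hochschildCocycles 𝒜 μ (p + 1) q) ∈
      (hochschildCoboundaries 𝒜 μ (p + 1) q).comap (hochschildCocycles 𝒜 μ (p + 1) q).subtype :=
    (Submodule.Quotient.mk_eq_zero _).1 (h.elim _ _)
  obtain ⟨_, ψ, hψ, he⟩ := hmem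
  exact ⟨ψ, hψ, fun a => congrFun he a⟩

theorem isElementary_shift_update {p : ℕ} (hp : 2 ≤ p)
    (ψ : MultilinearMap k (fun _ : Fin p => V) V) :
    IsElementary (shift 𝒜 (Function.update (idMaps k V) p ψ)) p where
  singleton x := by
    rw [shift_congr 𝒜 (g := idMaps k V) (Function.update_of_ne (by simp; omega) _ _),
      shift_idMaps, idWord_singleton]
  eq_zero u h₁ h₂ := by
    rw [shift_congr 𝒜 (g := idMaps k V) (Function.update_of_ne h₂ _ _), shift_idMaps]
    match u, h₁ with
    | [], _ => rfl
    | _ :: _ :: _, _ => rfl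

theorem isHomogeneous_idMaps (n : ℕ) : IsHomogeneous 𝒜 𝒜 (idMaps k V n) (1 - (n : ℤ)) := by
  match n with
  | 0 => exact isHomogeneous_zero _ _
  | 1 =>
    intro d a ha
    simpa [idMaps] using ha 0
  | n + 2 => exact isHomogeneous_zero _ _

/-- If the obstruction group vanishes, the first non-vanishing higher product can be removed. -/
theorem exists_remove_product (hN : Even N) {A : Algebra 𝒜} (hA : A.m 1 = 0) {p : ℕ} (hp : 2 ≤ p)
    (h : ∀ l, 3 ≤ l → l ≤ p → A.m l = 0)
    (hH : Subsingleton (HochschildCohomology 𝒜 (A.m 2) (p + 1) (2 - ((p + 1 : ℕ) : ℤ)))) :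
    ∃ (B : Algebra 𝒜) (F : Hom A B), B.m 1 = 0 ∧ B.m 2 = A.m 2 ∧
      (∀ l, 3 ≤ l → l ≤ p + 1 → B.m l = 0) ∧ F.f 1 = idMaps k V 1 ∧
      ∀ l, 1 < l → l < p → F.f l = 0 := by
  obtain ⟨ψ, hψ, hd⟩ := exists_hochschildDiff_eq hH (A.isHomogeneous (p + 1))
    (hochschildDiff_m_eq_zero hN hA (by omega) fun l h₁ h₂ => h l h₁ (by omega))
  have hq : (2 : ℤ) - ((p + 1 : ℕ) : ℤ) = 1 - p := by push_cast; ring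
  rw [hq] at hψ hd
  -- The sign of `ψ` is chosen so that the correction to the product of arity p + 1 is minus that
  -- product.
  set f := Function.update (idMaps k V) p (((-1 : k) ^ (p + 1)) • ψ) with hf
  have hfp : f p = ((-1 : k) ^ (p + 1)) • ψ := Function.update_self ..
  have hfo : ∀ l, l ≠ p → f l = idMaps k V l := fun l hl => Function.update_of_ne hl _ _
  have hfh : ∀ n : ℕ, IsHomogeneous 𝒜 𝒜 (f n) (1 - (n : ℤ)) := fun n => by
    rcases eq_or_ne n p with rfl | hn
    · rw [hfp]; exact fun d a ha => Submodule.smul_mem _ _ (hψ d a ha)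
    · rw [hfo n hn]; exact isHomogeneous_idMaps n
  have hf1 : f 1 = idMaps k V 1 := hfo 1 (by omega)
  obtain ⟨B, F, hF⟩ := Hom.exists_transport hN A f hfh (hfo 0 (by omega)) hf1
  have hel : IsElementary F.word p := by
    rw [Hom.word, hF]; exact isElementary_shift_update hp _
  have hA1 := word_singleton_eq_zero hA
  have hlt : ∀ w : List V, w.length < p → B.word w = A.word w := fun w hw => by
    rw [← hel.pull_of_lt B.isML_word hw, F.word_relation hN,
      hel.ins_of_le F.isML_word hA1 A.word_nil hw.le]
  -- In length `p` the only additional term is `B.word` on the single letter `F.word w`, which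
  -- vanishes by minimality.
  have hle : ∀ w : List V, w.length ≤ p → B.word w = A.word w := fun w hw => by
    rcases hw.lt_or_eq with hw | hw
    · exact hlt w hw
    · rw [← hel.ins_of_le (τ := tau 𝒜) F.isML_word hA1 A.word_nil hw.le, ← F.word_relation hN,
        hel.pull_of_eq hp B.isML_word hw, hlt [F.word w] (by simp; omega), hA1, add_zero]
  have hm : ∀ l, l ≤ p → B.m l = A.m l := fun l hl =>
    multilinear_eq_of_shift_eq 𝒜 fun w hw => hle w (by omega)
  refine ⟨B, F, by rw [hm 1 (by omega), hA], hm 2 hp, fun l h₁ h₂ => ?_, by rw [hF, hf1],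
    fun l h₁ h₂ => ?_⟩
  · rcases h₂.lt_or_eq with h₂ | rfl
    · rw [hm l (by omega), h l h₁ (by omega)]
    · refine eq_zero_of_shift 𝒜 fun w hw => ?_
      obtain ⟨a, ha⟩ := exists_shiftSeq 𝒜 w
      rw [hw] at ha
      have h2 : IsHomogeneous 𝒜 𝒜 (A.m 2) 0 := by simpa using A.isHomogeneous 2
      -- In length p + 1 this determines `B.word w`: it is `A.word w` plus the terms that make up
      -- the Hochschild differential of `f p`.
      have key := F.word_relation hN w
      rw [hel.pull_of_succ hp B.isML_word hw, hel.ins_of_succ hp F.isML_word hA1 hw,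
        hle [_, _] (by simpa using hp), hle [_, _] (by simpa using hp)] at key
      -- For q = 1 - p the exponent q + 1 + p is even and p + q is odd: the sign operator is the
      -- identity and both boundary terms carry a minus sign, as in `key`.
      have hD := hochschildDiff_eq hN (f := f) (hfh p) h2 a
      rw [hfp, map_smul, Pi.smul_apply, hd, apply_eq_shift 𝒜 A.m, ← ha,
        show ((p : ℤ) + (1 - p)).natAbs = 1 by simp, koszul_of_even 𝒜 ⟨1, by ring⟩, pow_one,
        neg_one_smul] at hD
      have hs : ((-1 : k) ^ p.choose 2) • A.word w = ((-1 : k) ^ p.choose 2) •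
          -(insTwo (tau 𝒜) A.word F.word p w + (-A.word [w.getD 0 0, F.word (w.drop 1)] +
            -A.word [F.word (w.take p), w.getD p 0])) := by
        rw [smul_neg]
        simp only [Hom.word, hF]
        refine Eq.trans ?_ (congrArg Neg.neg hD)
        rw [smul_smul, ← neg_smul, ← pow_add, neg_eq_neg_one_mul ((-1 : k) ^ _), ← pow_succ']
        congr 1
        refine neg_one_pow_congr ?_
        rw [choose_two_succ]
        simp only [Nat.even_iff]
        omega
      have hs' := smul_right_injective V (pow_ne_zero _ (neg_ne_zero.2 one_ne_zero)) hs
      have hB : B.word w = A.word w + insTwo (tau 𝒜) A.word F.word p w -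
          A.word [w.getD 0 0, F.word (w.drop 1)] - A.word [F.word (w.take p), w.getD p 0] := by
        rw [← key]; abel
      change B.word w = 0
      rw [hB, hs']
      abel
  · rw [hF, hfo l h₂.ne]
    match l, h₁ with
    | l + 2, _ => rfl

theorem Hom.comp_f_one (hN : Even N) {A B C : Algebra 𝒜} (G : Hom B C) (F : Hom A B)
    (hG : G.f 1 = idMaps k V 1) (hF : F.f 1 = idMaps k V 1) :
    (comp hN G F).f 1 = idMaps k V 1 := by
  refine multilinear_eq_of_shift_eq 𝒜 fun w hw => ?_
  obtain ⟨x, rfl⟩ := List.length_eq_one_iff.1 hw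
  have e : shift 𝒜 (comp hN G F).f = pull F.word G.word := word_ofWord ..
  rw [e, shift_idMaps]
  simp [pull, pullAux, F.word_singleton hF, G.word_singleton hG, idWord_singleton]

/-- Components of low order of a composite `G ∘ F` with `G` trivial in low orders. -/
theorem Hom.comp_f_eq (hN : Even N) {A B C : Algebra 𝒜} (G : Hom B C) (F : Hom A B)
    (hG : G.f 1 = idMaps k V 1) {j : ℕ} (h : ∀ l, 1 < l → l < j → G.f l = 0) {n : ℕ}
    (hn : n < j) : (comp hN G F).f n = F.f n := by
  refine multilinear_eq_of_shift_eq 𝒜 fun w hw => ?_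
  have e : shift 𝒜 (comp hN G F).f = pull F.word G.word := word_ofWord ..
  rw [e, pull_congr (Ψ := idWord), pull_idWord F.word_nil]
  · rfl
  · intro v hv
    match v with
    | [] => exact G.word_nil
    | [x] => exact G.word_singleton hG x
    | x :: y :: v =>
      rw [idWord_cons_cons]
      exact shift_eq_zero 𝒜 (h _ (by simp) (by omega))

/-- Successive removal of the higher products up to order `M`. -/
theorem exists_trivial_up_to (hN : Even N) {A : Algebra 𝒜} (hA : A.m 1 = 0) (M : ℕ)
    (hH : ∀ n : ℕ, 3 ≤ n → n ≤ M →
      Subsingleton (HochschildCohomology 𝒜 (A.m 2) n (2 - (n : ℤ)))) :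
    ∃ (B : Algebra 𝒜) (F : Hom A B), B.m 1 = 0 ∧ B.m 2 = A.m 2 ∧
      (∀ l, 3 ≤ l → l ≤ M → B.m l = 0) ∧ F.f 1 = idMaps k V 1 := by
  induction M with
  | zero => exact ⟨A, Hom.id hN A, hA, rfl, fun l _ _ => by omega, by rw [Hom.id_f]⟩
  | succ M ih =>
    obtain ⟨B, F, h₁, h₂, h₃, h₄⟩ := ih fun n hn hn' => hH n hn (by omega)
    -- For `M < 2` no operation of arity at least 3 is concerned.
    rcases lt_or_ge M 2 with hM | hM
    · exact ⟨B, F, h₁, h₂, fun l _ _ => by omega, h₄⟩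
    · obtain ⟨C, G, g₁, g₂, g₃, g₄, _⟩ := exists_remove_product hN h₁ hM h₃
        (h₂ ▸ hH (M + 1) (by omega) le_rfl)
      exact ⟨C, Hom.comp hN G F, g₁, g₂.trans h₂, g₃, Hom.comp_f_one hN G F g₄ h₄⟩

/-- With `compSum_congr`, this lets each relation pass to a limit that is stable in every arity. -/
theorem insertSum_congr {W : Type*} [AddCommGroup W] [Module k W]
    {f f' : ∀ n : ℕ, MultilinearMap k (fun _ : Fin n => V) W}
    {m m' : ∀ n : ℕ, MultilinearMap k (fun _ : Fin n => V) V} {n : ℕ}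
    (hf : ∀ l ≤ n, f l = f' l) (hm : ∀ l ≤ n, m l = m' l) (a : ℕ → V) :
    insertSum 𝒜 f m n a = insertSum 𝒜 f' m' n a := by
  refine Finset.sum_congr rfl fun s hs => Finset.sum_congr rfl fun r _ => ?_
  rw [Finset.mem_Icc] at hs
  rw [hf (n - s + 1) (by omega), hm s hs.2]

theorem compSum_congr {g g' f f' : ∀ n : ℕ, MultilinearMap k (fun _ : Fin n => V) V} {n : ℕ}
    (hg : ∀ l ≤ n, g l = g' l) (hf : ∀ l ≤ n, f l = f' l) (a : ℕ → V) :
    compSum 𝒜 g f n a = compSum 𝒜 g' f' n a := by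
  refine Finset.sum_congr rfl fun c _ => ?_
  rw [hg _ c.length_le]
  simp only [hf _ (c.blocksFun_le _)]

/-- A morphism to a trivial algebra which is the limit of morphisms `F j : A → B j`. -/
theorem exists_limit {A : Algebra 𝒜} (B : ℕ → Algebra 𝒜) (F : ∀ j, Hom A (B j))
    (h1 : ∀ j, (B j).m 1 = 0) (h2 : ∀ j, (B j).m 2 = A.m 2)
    (h3 : ∀ j l, 3 ≤ l → l ≤ j + 2 → (B j).m l = 0)
    (hF : ∀ j n, n ≤ j + 1 → (F (j + 1)).f n = (F j).f n) :
    ∃ (T : Algebra 𝒜) (Φ : Hom A T), T.IsTrivial ∧ T.m 2 = A.m 2 ∧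
      ∀ n j : ℕ, n ≤ j + 1 → (F j).f n = Φ.f n := by
  have hstab : ∀ n i j, i ≤ j → n ≤ i + 1 → (F j).f n = (F i).f n := by
    intro n i j hij hn
    induction j, hij using Nat.le_induction with
    | base => rfl
    | succ j hij ih => rw [hF j n (by omega), ih]
  -- The component of arity `n` is already stable from `j = n - 1` on; `F n` serves as the
  -- representative and avoids the subtraction.
  have hstab' : ∀ n j, n ≤ j + 1 → (F j).f n = (F n).f n := by
    intro n j hn
    rw [← hstab n j (max j n) (le_max_left _ _) hn,
      hstab n n (max j n) (le_max_right _ _) (by omega)]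
  let t : ∀ n : ℕ, MultilinearMap k (fun _ : Fin n => V) V := Function.update (fun _ => 0) 2 (A.m 2)
  have ht2 : t 2 = A.m 2 := Function.update_self ..
  have ht : ∀ l, l ≠ 2 → t l = 0 := fun l hl => Function.update_of_ne hl _ _
  -- Up to arity `n` the trivial structure agrees with `B n`, so its relation of arity `n`, and that
  -- of `Φ`, are those of `B n` and `F n`.
  have htB : ∀ j l, l ≤ j → t l = (B j).m l := by
    intro j l hl
    rcases eq_or_ne l 2 with rfl | hl2
    · rw [ht2, h2]
    · rw [ht l hl2]
      match l, hl, hl2 with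
      | 0, _, _ => exact (B j).m_zero.symm
      | 1, _, _ => exact (h1 j).symm
      | l + 3, hl, _ => exact (h3 j _ (by omega) (by omega)).symm
  let T : Algebra 𝒜 :=
    { m := t
      m_zero := ht 0 (by omega)
      homogeneous := fun n hn => by rw [htB n n le_rfl]; exact (B n).homogeneous n hn
      relation := fun n hn a => by
        rw [insertSum_congr (htB n) (htB n)]; exact (B n).relation n hn a }
  let Φ : Hom A T :=
    { f := fun n => (F n).f n
      f_zero := (F 0).f_zero
      homogeneous := fun n hn => (F n).homogeneous n hn
      relation := fun n hn a => by
        have hΦ : ∀ l ≤ n, (F l).f l = (F n).f l := fun l hl => (hstab' l n (by omega)).symm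
        rw [compSum_congr (htB n) hΦ, insertSum_congr hΦ fun _ _ => rfl]
        exact (F n).relation n hn a }
  exact ⟨T, Φ, ht, ht2, hstab'⟩

theorem isQuasiIso_of_minimal {A T : Algebra 𝒜} (hA : A.m 1 = 0) (hT : T.m 1 = 0) {Φ : Hom A T}
    (h : Φ.f 1 = idMaps k V 1) : Φ.IsQuasiIso := by
  have e : ∀ x, linearPart (Φ.f 1) x = x := fun x => by
    rw [h]; simp [linearPart, idMaps]
  have dA : A.d = 0 := by rw [Algebra.d, hA]; ext; simp [linearPart]
  have dT : T.d = 0 := by rw [Algebra.d, hT]; ext; simp [linearPart]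
  simp [Hom.IsQuasiIso, dA, dT, e, sub_eq_zero]

/-- The sequence of structures and morphisms obtained by removing the products one after the
other. -/
theorem exists_sequence (hN : Even N) {A : Algebra 𝒜} (hA : A.m 1 = 0)
    (hH : ∀ n : ℕ, 3 ≤ n → Subsingleton (HochschildCohomology 𝒜 (A.m 2) n (2 - (n : ℤ)))) :
    ∃ (B : ℕ → Algebra 𝒜) (G : ∀ j : ℕ, Hom (B j) (B (j + 1))) (F : ∀ j : ℕ, Hom A (B j)),
      B 0 = A ∧
      (∀ j, (B j).m 1 = 0 ∧ (B j).m 2 = A.m 2 ∧ ∀ l, 3 ≤ l → l ≤ j + 2 → (B j).m l = 0) ∧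
      (∀ j, (G j).f 1 = idMaps k V 1 ∧ ∀ l, 1 < l → l < j + 2 → (G j).f l = 0) ∧
      (F 0).f = idMaps k V ∧ ∀ j, F (j + 1) = Hom.comp hN (G j) (F j) := by
  let P : ℕ → Algebra 𝒜 → Prop := fun j B =>
    B.m 1 = 0 ∧ B.m 2 = A.m 2 ∧ ∀ l, 3 ≤ l → l ≤ j + 2 → B.m l = 0
  have step : ∀ j (B : Algebra 𝒜), P j B → ∃ (C : Algebra 𝒜) (G : Hom B C), P (j + 1) C ∧
      G.f 1 = idMaps k V 1 ∧ ∀ l, 1 < l → l < j + 2 → G.f l = 0 := by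
    rintro j B ⟨h₁, h₂, h₃⟩
    obtain ⟨C, G, g₁, g₂, g₃, g₄, g₅⟩ := exists_remove_product hN h₁ (p := j + 2) (by omega) h₃
      (h₂ ▸ hH (j + 2 + 1) (by omega))
    exact ⟨C, G, ⟨g₁, g₂.trans h₂, fun l hl hl' => g₃ l hl (by omega)⟩, g₄, g₅⟩
  choose C G hC hG hG' using step
  -- The recursion carries the property `P` along, since the next step can be chosen only under it;
  -- at `j = 0` the range `3 ≤ l ≤ 2` is empty.
  let S : ∀ j : ℕ, {B : Algebra 𝒜 // P j B} := fun j =>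
    Nat.rec ⟨A, hA, rfl, fun l hl hl' => absurd (hl.trans hl') (by decide)⟩
      (fun j B => ⟨C j B.1 B.2, hC j B.1 B.2⟩) j
  let G' : ∀ j, Hom (S j).1 (S (j + 1)).1 := fun j => G j (S j).1 (S j).2
  let F : ∀ j, Hom A (S j).1 := fun j =>
    Nat.rec (motive := fun j => Hom A (S j).1) (Hom.id hN A) (fun j Fj => Hom.comp hN (G' j) Fj) j
  exact ⟨fun j => (S j).1, G', F, rfl, fun j => (S j).2,
    fun j => ⟨hG j (S j).1 (S j).2, hG' j (S j).1 (S j).2⟩, Hom.id_f hN A, fun _ => rfl⟩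

end Formality

end AInf

/-! ### Assembly of the three statements -/

theorem mainTheorem3 {k : Type*} [Field k] {N : ℕ} (hN : Even N)
    {V : Type*} [AddCommGroup V] [Module k V]
    (𝒜 : ZMod N → Submodule k V) [DirectSum.Decomposition 𝒜]
    (A : AInf.Algebra 𝒜) (hA : A.IsMinimal) :
    -- removal of the first non-zero higher product
    (∀ n : ℕ, 3 ≤ n → (∀ l : ℕ, 3 ≤ l → l < n → A.m l = 0) →
      Subsingleton (AInf.HochschildCohomology 𝒜 (A.m 2) n (2 - (n : ℤ))) →
      ∃ (B : AInf.Algebra 𝒜) (F : AInf.Hom A B),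
        B.IsMinimal ∧ B.m 2 = A.m 2 ∧ (∀ l : ℕ, 3 ≤ l → l ≤ n → B.m l = 0) ∧
        F.f 1 = AInf.idMaps k V 1 ∧ (∀ l : ℕ, 1 < l → l < n - 1 → F.f l = 0) ∧ F.IsIso) ∧
    -- trivialisation up to a given order
    (∀ M : ℕ,
      (∀ n : ℕ, 3 ≤ n → n ≤ M →
        Subsingleton (AInf.HochschildCohomology 𝒜 (A.m 2) n (2 - (n : ℤ)))) →
      ∃ (B : AInf.Algebra 𝒜) (F : AInf.Hom A B),
        B.IsMinimal ∧ B.m 2 = A.m 2 ∧ (∀ l : ℕ, 3 ≤ l → l ≤ M → B.m l = 0) ∧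
        F.f 1 = AInf.idMaps k V 1 ∧ F.IsIso) ∧
    -- trivialisation to all orders, as the limit of the successive composites
    ((∀ n : ℕ, 3 ≤ n →
        Subsingleton (AInf.HochschildCohomology 𝒜 (A.m 2) n (2 - (n : ℤ)))) →
      (∃ (B : ℕ → AInf.Algebra 𝒜) (G : ∀ j : ℕ, AInf.Hom (B j) (B (j + 1)))
          (F : ∀ j : ℕ, AInf.Hom A (B j)) (T : AInf.Algebra 𝒜) (Φ : AInf.Hom A T),
        B 0 = A ∧
        (∀ j : ℕ, (B j).IsMinimal ∧ (B j).m 2 = A.m 2 ∧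
          ∀ l : ℕ, 3 ≤ l → l ≤ j + 2 → (B j).m l = 0) ∧
        (∀ j : ℕ, (G j).IsIso ∧ (G j).f 1 = AInf.idMaps k V 1 ∧
          ∀ l : ℕ, 1 < l → l < j + 2 → (G j).f l = 0) ∧
        (F 0).f = AInf.idMaps k V ∧
        (∀ j : ℕ, (G j).IsComp (F j) (F (j + 1))) ∧
        T.IsTrivial ∧ T.m 2 = A.m 2 ∧
        (∀ n j : ℕ, n ≤ j + 1 → (F j).f n = Φ.f n) ∧
        Φ.f 1 = AInf.idMaps k V 1 ∧ Φ.IsIso) ∧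
      A.IsFormal) := by
  refine ⟨fun n hn hm hH => ?_, fun M hH => ?_, fun hH => ?_⟩
  · obtain ⟨p, rfl⟩ : ∃ p, n = p + 1 := ⟨n - 1, by omega⟩
    obtain ⟨B, F, h₁, h₂, h₃, h₄, h₅⟩ := AInf.exists_remove_product hN hA (by omega)
      (fun l hl hl' => hm l hl (by omega)) hH
    exact ⟨B, F, h₁, h₂, h₃, h₄, h₅, F.isIso_of_f_one hN h₄⟩
  · obtain ⟨B, F, h₁, h₂, h₃, h₄⟩ := AInf.exists_trivial_up_to hN hA M hH
    exact ⟨B, F, h₁, h₂, h₃, h₄, F.isIso_of_f_one hN h₄⟩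
  · obtain ⟨B, G, F, hB0, hB, hG, hF0, hF⟩ := AInf.exists_sequence hN hA hH
    obtain ⟨T, Φ, hT, hT2, hΦ⟩ := AInf.exists_limit B F (fun j => (hB j).1) (fun j => (hB j).2.1)
      (fun j => (hB j).2.2) fun j n hn => by
        rw [hF]
        exact AInf.Hom.comp_f_eq hN (G j) (F j) (hG j).1 (hG j).2 (by omega)
    -- Arity 1 is stable from `j = 0` on, where the composite is the identity.
    have hΦ1 : Φ.f 1 = AInf.idMaps k V 1 := by rw [← hΦ 1 0 le_rfl, hF0]
    refine ⟨⟨B, G, F, T, Φ, hB0, hB, fun j => ⟨(G j).isIso_of_f_one hN (hG j).1, hG j⟩, hF0,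
      fun j => ?_, hT, hT2, hΦ, hΦ1, Φ.isIso_of_f_one hN hΦ1⟩,
      V, _, _, 𝒜, _, T, Φ, hT, AInf.isQuasiIso_of_minimal hA (hT 1 (by omega)) hΦ1⟩
    rw [hF]
    exact AInf.Hom.isComp_comp hN (G j) (F j)
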